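/- Let $d,p\ge 1$ and $\kappa\ge 1$ be integers, and let $\Delta\subset\mathbb R^d$ be a bounded convex set containing the origin in its interior; for $r>0$ put $\Delta(r)=r\Delta$. Let $H_k$ be the (probabilists') Hermite polynomials, let $\phi(\|w\|)=(2\pi)^{-p/2}e^{-\|w\|^2/2}$, $w\in\mathbb R^p$, and for $k\ge 0$ let $N_k=\{\nu=(k_1,\dots,k_p)\in\mathbb Z_{\ge0}^p:\ k_1+\dots+k_p=k\}$; for $\nu=(k_1,\dots,k_p)$ put $e_\nu(w)=\prod_{j=1}^pH_{k_j}(w_j)$ and $\nu!=k_1!\cdots k_p!$. A function $G\in L_2(\mathbb R^p,\phi(\|w\|)\,dw)$ with Hermite coefficients $C_\nu=\int_{\mathbb R^p}G(w)e_\nu(w)\phi(\|w\|)\,dw$ has Hermite rank $\kappa$ if $C_\nu=0$ for all $\nu\in N_k$, $0\le k\le\kappa-1$, and $C_\nu\ne0$ for at least one $\nu\in N_\kappa$. Let $\eta(x)=[\eta_1(x),\dots,\eta_p(x)]'$, $x\in\mathbb R^d$, be a measurable mean-square continuous homogeneous isotropic vector Gaussian random field (the mean is constant, and the covariance matrix of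 $\eta(x)$ and $\eta(y)$ depends only on $\|x-y\|$) with $\mathbf E\,\eta(x)=0$, $\mathbf E\,\eta(0)\eta(0)'=\mathcal I$ and $$\mathbf E\,\eta(0)\eta(x)'=\mathcal I\cdot\|x\|^{-\alpha}L(\|x\|),\qquad x\neq0,$$ where $\mathcal I$ is the $p\times p$ unit matrix, $\alpha\in(0,d/\kappa)$ and $L$ is slowly varying at infinity, that is, $L$ is positive and measurable on some half-line $[t_0,\infty)$ and $L(ct)/L(t)\to1$ as $t\to\infty$ for every $c>0$. For each $r$ let $G_r:\mathbb R^p\to\mathbb R$ be a function such that, for all sufficiently large $r$, $G_r\in L_2(\mathbb R^p,\phi(\|w\|)\,dw)$ has Hermite rank $\kappa$; denote by $C_\nu(r)$ its Hermite coefficients. Suppose that for some $\gamma\in(0,\min(\alpha,d-\alpha\kappa))$ $$\Bigl(\sum_{\nu\in N_\kappa}\frac{C_\nu^2(r)}{\nu!}\Bigr)^{-1}\sum_{l\ge\kappa+1}\sum_{\nu\in N_l}\frac{C_\nu^2(r)}{\nu!}=o(r^{\gamma/2}),\qquad r\to\infty.$$ Put $$K_r=\int_{\Delta(r)}G_r(\eta(x))\,dx,\qquad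 K_{r,\kappa}=\sum_{\nu\in N_\kappa}\frac{C_\nu(r)}{\nu!}\int_{\Delta(r)}e_\nu(\eta(x))\,dx .$$ Then, as $r\to\infty$, if at least one of the random variables $$\frac{K_r}{\sqrt{\operatorname{Var}K_r}}\qquad\text{and}\qquad\frac{K_{r,\kappa}}{\sqrt{\operatorname{Var}K_{r,\kappa}}}$$ has a limit distribution, then so does the other one, and the two limit distributions coincide. Moreover, $\operatorname{Var}K_r/\operatorname{Var}K_{r,\kappa}\to1$. -/

import Mathlib

open MeasureTheory ProbabilityTheory Filter Topology Asymptotics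
open scoped Pointwise BoundedContinuousFunction

namespace GaussianReduction

/-! ### Multidimensional Hermite expansions -/

/-- The standard Gaussian measure `φ(‖w‖) dw` on `ℝᵖ`, as a product of standard normal laws. -/
noncomputable def stdGauss (p : ℕ) : Measure (Fin p → ℝ) :=
  Measure.pi fun _ => gaussianReal 0 1

/-- The multi-indices `ν = (k₁, …, k_p)` of nonnegative integers with `k₁ + ⋯ + k_p = k`. -/
def multiIdx (p k : ℕ) : Finset (Fin p → ℕ) :=
  Finset.piAntidiag Finset.univ k

/-- `ν! = k₁! ⋯ k_p!`. -/
def multiFactorial {p : ℕ} (ν : Fin p → ℕ) : ℕ :=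
  ∏ j, (ν j).factorial

/-- `e_ν(w) = ∏ⱼ H_{kⱼ}(wⱼ)`, with the probabilists' Hermite polynomials
`H₀ = 1`, `H₁ = u`, `H₂ = u² - 1`, …. -/
noncomputable def hermiteProd {p : ℕ} (ν : Fin p → ℕ) (w : Fin p → ℝ) : ℝ :=
  ∏ j, Polynomial.aeval (w j) (Polynomial.hermite (ν j))

/-- The Hermite coefficient `C_ν = ∫ G(w) e_ν(w) φ(‖w‖) dw`. -/
noncomputable def hermiteCoeff {p : ℕ} (G : (Fin p → ℝ) → ℝ) (ν : Fin p → ℕ) : ℝ :=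
  ∫ w, G w * hermiteProd ν w ∂(stdGauss p)

/-- `∑_{ν ∈ N_k} C_ν² / ν!`, the squared norm of the component of order `k` of `G`. -/
noncomputable def hermiteEnergy {p : ℕ} (G : (Fin p → ℝ) → ℝ) (k : ℕ) : ℝ :=
  ∑ ν ∈ multiIdx p k, hermiteCoeff G ν ^ 2 / (multiFactorial ν : ℝ)

/-- `G ∈ L₂(ℝᵖ, φ(‖w‖) dw)` has Hermite rank `κ ≥ 1`. -/
structure HasHermiteRank {p : ℕ} (G : (Fin p → ℝ) → ℝ) (κ : ℕ) : Prop where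
  memLp : MemLp G 2 (stdGauss p)
  one_le : 1 ≤ κ
  coeff_eq_zero : ∀ k < κ, ∀ ν ∈ multiIdx p k, hermiteCoeff G ν = 0
  exists_coeff_ne_zero : ∃ ν ∈ multiIdx p κ, hermiteCoeff G ν ≠ 0

/-! ### Slowly varying functions and Gaussian fields -/

/-- `L` is slowly varying at infinity: it is positive and measurable on some half-line `[t₀, ∞)`,
and `L(ct) / L(t) → 1` as `t → ∞` for every `c > 0`. -/
def IsSlowlyVarying (L : ℝ → ℝ) : Prop :=
  (∃ t₀ : ℝ, (∀ t ≥ t₀, 0 < L t) ∧ Measurable ((Set.Ici t₀).domRestrict L)) ∧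
    ∀ c > 0, Tendsto (fun t => L (c * t) / L t) atTop (𝓝 1)

/-- A measurable mean-square continuous homogeneous isotropic `ℝᵖ`-valued Gaussian random field
on `ℝᵈ`: all finite-dimensional distributions are Gaussian, the mean vector is constant and the
covariance matrix of `η(x)` and `η(y)` is a function of the distance `‖x - y‖`. -/
structure IsHomIsoGaussianField {d p : ℕ} {Ω : Type*} [MeasurableSpace Ω]
    (η : EuclideanSpace ℝ (Fin d) → Ω → (Fin p → ℝ)) (P : Measure Ω) : Prop where
  measurable : Measurable fun q : EuclideanSpace ℝ (Fin d) × Ω => η q.1 q.2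
  gaussian : IsGaussianProcess η P
  meanSquareContinuous : ∀ x,
    Tendsto (fun y => ∫ ω, ∑ i, (η y ω i - η x ω i) ^ 2 ∂P) (𝓝 x) (𝓝 0)
  mean_const : ∀ x y i, ∫ ω, η x ω i ∂P = ∫ ω, η y ω i ∂P
  cov_isotropic : ∀ x y x' y' i j, ‖x - y‖ = ‖x' - y'‖ →
    cov[fun ω => η x ω i, fun ω => η y ω j; P] = cov[fun ω => η x' ω i, fun ω => η y' ω j; P]

/-- The strong dependence assumption: `η` is a zero-mean homogeneous isotropic Gaussian field with
`E η(0) η(0)' = I` and `E η(0) η(x)' = I · ‖x‖^(-α) L(‖x‖)` for `x ≠ 0`, where `α > 0` and `L` is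
slowly varying at infinity. -/
structure IsStronglyDependentField {d p : ℕ} {Ω : Type*} [MeasurableSpace Ω]
    (η : EuclideanSpace ℝ (Fin d) → Ω → (Fin p → ℝ)) (P : Measure Ω)
    (α : ℝ) (L : ℝ → ℝ) : Prop where
  field : IsHomIsoGaussianField η P
  alpha_pos : 0 < α
  slowlyVarying : IsSlowlyVarying L
  mean_zero : ∀ x i, ∫ ω, η x ω i ∂P = 0
  cov_zero : ∀ i j, ∫ ω, η 0 ω i * η 0 ω j ∂P = (1 : Matrix (Fin p) (Fin p) ℝ) i j
  cov_eq : ∀ x, x ≠ 0 → ∀ i j, ∫ ω, η 0 ω i * η x ω j ∂P =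
    (1 : Matrix (Fin p) (Fin p) ℝ) i j * (‖x‖ ^ (-α) * L ‖x‖)

/-! ### The functionals and their limit laws -/

/-- `K_r = ∫_{Δ(r)} G_r(η(x)) dx`, where `Δ(r) = r • Δ`. -/
noncomputable def fullFunctional {d p : ℕ} {Ω : Type*}
    (Δ : Set (EuclideanSpace ℝ (Fin d))) (G : ℝ → (Fin p → ℝ) → ℝ)
    (η : EuclideanSpace ℝ (Fin d) → Ω → (Fin p → ℝ)) (r : ℝ) (ω : Ω) : ℝ :=
  ∫ x in r • Δ, G r (η x ω)

/-- `K_{r,κ} = ∑_{ν ∈ N_κ} (C_ν(r) / ν!) ∫_{Δ(r)} e_ν(η(x)) dx`. -/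
noncomputable def rankFunctional {d p : ℕ} {Ω : Type*}
    (Δ : Set (EuclideanSpace ℝ (Fin d))) (G : ℝ → (Fin p → ℝ) → ℝ) (κ : ℕ)
    (η : EuclideanSpace ℝ (Fin d) → Ω → (Fin p → ℝ)) (r : ℝ) (ω : Ω) : ℝ :=
  ∑ ν ∈ multiIdx p κ, hermiteCoeff (G r) ν / (multiFactorial ν : ℝ) *
    ∫ x in r • Δ, hermiteProd ν (η x ω)

/-- The probability law `μ` is the limit distribution of `X_r` as `r → ∞`. -/
def HasLimitLaw {Ω : Type*} [MeasurableSpace Ω] (P : Measure Ω) (X : ℝ → Ω → ℝ)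
    (μ : ProbabilityMeasure ℝ) : Prop :=
  (∀ᶠ r in atTop, AEMeasurable (X r) P) ∧
    ∀ f : ℝ →ᵇ ℝ, Tendsto (fun r => ∫ ω, f (X r ω) ∂P) atTop (𝓝 (∫ t, f t ∂(μ : Measure ℝ)))

end GaussianReduction

open GaussianReduction

/-! Write `B` for the common correlation function of the coordinates and `E_l` for `hermiteEnergy (G
r) l`. If `X`, `Y` are jointly Gaussian standard vectors with cross-covariance `ρ • 1`, Mehler's
formula (`IsCorrelatedPair.hasSum_integral_mul`) gives `E F(X)G(Y) = ∑ C_ν(F) C_ν(G) ρ^|ν| / ν!`.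
Hermite components of different orders are thus uncorrelated even at different points of the field.
So `K_{r,κ}` is uncorrelated with the remainder `K_r - K_{r,κ}`, and `Var K_r` is the sum of their
variances. Here `Var K_{r,κ} = E_κ ∬ B^κ`, while `|B| ≤ 1` bounds the remainder's variance by
`(∑_{l>κ} E_l) ∬ |B|^(κ+1)`.

It remains to compare the two double integrals over `Δ(r)` (`tendsto_corr_integral_ratio`). Since
`L` grows and decays slower than any power, `∬ B^κ ≥ c r^(2d - ακ - γ/8)` for large `r` and `∬
|B|^(κ+1) ≤ C r^(2d - ακ - 3γ/4)`. Their ratio beats the factor `o(r^(γ/2))` allowed for the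
energies, so the variance ratio tends to 1. The squared `L²` distance between the standardized
functionals is `2 - 2 / √(Var K_r / Var K_{r,κ})` (`integral_sq_sub_standardized`); it tends to 0,
and the limit laws agree.

Two analytic inputs support this. Mehler's formula for general `L²` functions needs completeness of
the Hermite products: a function orthogonal to all of them has vanishing Fourier transform against
the Gaussian weight. The power bounds on `L` come from a Baire argument, which applies because
mean-square continuity of the field makes `B`, hence `L` on `(0, ∞)`, continuous. -/

namespace GaussianReduction

open Polynomial NNReal

/-! ### Hermite polynomials and one-dimensional Gaussian laws -/

lemma integrable_eval_gaussianReal (Q : ℝ[X]) (m : ℝ) (v : ℝ≥0) :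
    Integrable (fun x => Q.eval x) (gaussianReal m v) := by
  induction Q using Polynomial.induction_on' with
  | add Q R hQ hR => simpa using! hQ.add hR
  | monomial n a =>
    simp only [eval_monomial]
    refine Integrable.const_mul ?_ a
    exact integrable_pow_of_mem_interior_integrableExpSet (X := id)
      (by simp [integrableExpSet_id_gaussianReal]) n

lemma hasDerivAt_gaussianPDFReal_zero_one (x : ℝ) :
    HasDerivAt (gaussianPDFReal 0 1) (-x * gaussianPDFReal 0 1 x) x := by
  have h : gaussianPDFReal 0 1 = fun x => (√(2 * Real.pi))⁻¹ * Real.exp (-(x ^ 2) / 2) := by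
    ext x; simp [gaussianPDFReal]
  rw [h]
  have h1 : HasDerivAt (fun x : ℝ => -(x ^ 2) / 2) (-x) x := by
    have := ((hasDerivAt_pow 2 x).neg).div_const 2
    convert! this using 1; simp; ring
  convert! (h1.exp.const_mul ((√(2 * Real.pi))⁻¹)) using 1
  ring

/-- Gaussian integration by parts for polynomials, standard normal case. -/
lemma integral_mul_eval_stdNormal (Q : ℝ[X]) :
    ∫ x, x * Q.eval x ∂(gaussianReal 0 1) = ∫ x, (derivative Q).eval x ∂(gaussianReal 0 1) := by
  have hI : ∀ R : ℝ[X], Integrable (fun x => R.eval x * gaussianPDFReal 0 1 x) := by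
    intro R
    have := integrable_eval_gaussianReal R 0 1
    rw [gaussianReal_of_var_ne_zero _ one_ne_zero,
      integrable_withDensity_iff_integrable_smul' (by fun_prop)
        (ae_of_all _ fun _ => gaussianPDF_lt_top)] at this
    refine this.congr (ae_of_all _ fun x => ?_)
    simp [toReal_gaussianPDF, mul_comm]
  rw [integral_gaussianReal_eq_integral_smul one_ne_zero,
    integral_gaussianReal_eq_integral_smul one_ne_zero]
  have key := integral_mul_deriv_eq_deriv_mul_of_integrable
    (u := fun x => Q.eval x) (u' := fun x => (derivative Q).eval x)
    (v := gaussianPDFReal 0 1) (v' := fun x => -x * gaussianPDFReal 0 1 x)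
    (fun x _ => Q.hasDerivAt x) (fun x _ => hasDerivAt_gaussianPDFReal_zero_one x) ?_ (hI _) (hI _)
  · have e1 : ∫ x, gaussianPDFReal 0 1 x • (x * Q.eval x)
        = -∫ x, Q.eval x * (-x * gaussianPDFReal 0 1 x) := by
      rw [← integral_neg]; congr 1; ext x; simp only [smul_eq_mul]; ring
    rw [e1, key, neg_neg]
    congr 1; ext x; simp only [smul_eq_mul]; ring
  · refine (hI (-(X * Q))).congr (ae_of_all _ fun x => ?_)
    simp only [Pi.mul_apply, eval_neg, eval_mul, eval_X]; ring

/-- Gaussian integration by parts for polynomials. -/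
lemma integral_mul_eval_gaussianReal (Q : ℝ[X]) (v : ℝ≥0) :
    ∫ x, x * Q.eval x ∂(gaussianReal 0 v) = v * ∫ x, (derivative Q).eval x ∂(gaussianReal 0 v) := by
  -- Scaling reduces to unit variance: one factor `√v` comes from `x`, the other from the chain
  -- rule.
  have hv : gaussianReal 0 v = (gaussianReal 0 1).map (√(v : ℝ) * ·) := by
    rw [gaussianReal_map_const_mul]
    congr 1
    · simp
    · ext; simp
  have h1 : ∀ R : ℝ[X], ∫ x, R.eval x ∂(gaussianReal 0 v)
      = ∫ x, (R.comp (C √(v : ℝ) * X)).eval x ∂(gaussianReal 0 1) := by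
    intro R
    rw [hv, integral_map (by fun_prop) (by fun_prop)]
    simp [eval_comp]
  have h2 := h1 (X * Q)
  simp only [eval_mul, eval_X] at h2
  rw [h2, h1]
  have h3 := integral_mul_eval_stdNormal (Q.comp (C √(v : ℝ) * X))
  simp only [derivative_comp, derivative_mul, derivative_C, derivative_X, eval_comp, eval_mul,
    eval_C, eval_X, zero_mul, zero_add, mul_one, integral_const_mul, mul_comp, X_comp, mul_assoc] at h3 ⊢
  rw [h3, ← mul_assoc, Real.mul_self_sqrt v.coe_nonneg]

/-- The `n`-th probabilists' Hermite polynomial with real coefficients. -/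
noncomputable def hermiteR (n : ℕ) : ℝ[X] := (hermite n).map (Int.castRingHom ℝ)

lemma aeval_hermite_eq (n : ℕ) (x : ℝ) : aeval x (hermite n) = (hermiteR n).eval x := by
  simp [hermiteR, aeval_def, eval₂_eq_eval_map]

lemma hermiteR_zero : hermiteR 0 = 1 := by simp [hermiteR]

lemma hermiteR_succ (n : ℕ) : hermiteR (n + 1) = X * hermiteR n - derivative (hermiteR n) := by
  simp [hermiteR, hermite_succ]

/-- Differentiating `H_{n+2} = X H_{n+1} - H_{n+1}'` and inserting the induction hypothesis
reproduces the recursion for `H_{n+1}`. -/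
lemma derivative_hermiteR_succ (n : ℕ) :
    derivative (hermiteR (n + 1)) = (n + 1 : ℝ[X]) * hermiteR n := by
  induction n with
  | zero => simp [hermiteR_succ, hermiteR_zero]
  | succ n ih =>
    rw [hermiteR_succ (n + 1), derivative_sub, derivative_mul, ih, derivative_mul, hermiteR_succ n]
    have : derivative ((n : ℝ[X]) + 1) = 0 := by simp
    rw [this]; simp; ring

lemma hermiteR_succ_succ (n : ℕ) :
    hermiteR (n + 2) = X * hermiteR (n + 1) - (n + 1 : ℝ[X]) * hermiteR n := by
  rw [hermiteR_succ (n + 1), derivative_hermiteR_succ]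

/-- Under the standard normal law `f ↦ x f - f'` is adjoint to differentiation, and it maps `H_n` to
`H_{n+1}`. -/
lemma integral_hermiteR_succ_mul (n : ℕ) (Q : ℝ[X]) :
    ∫ x, (hermiteR (n + 1)).eval x * Q.eval x ∂(gaussianReal 0 1)
      = ∫ x, (hermiteR n).eval x * (derivative Q).eval x ∂(gaussianReal 0 1) := by
  have h := integral_mul_eval_stdNormal (hermiteR n * Q)
  have hi := integrable_eval_gaussianReal (derivative (hermiteR n) * Q) 0 1
  have hi2 := integrable_eval_gaussianReal (hermiteR n * derivative Q) 0 1
  have hi3 := integrable_eval_gaussianReal (X * (hermiteR n * Q)) 0 1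
  simp only [derivative_mul, eval_add, eval_mul, eval_X] at h hi hi2 hi3
  rw [integral_add hi hi2] at h
  rw [hermiteR_succ, ← sub_eq_iff_eq_add'] at *
  rw [← h, ← integral_sub hi3 hi]
  congr 1; ext x; simp only [eval_sub, eval_mul, eval_X]; ring

/-- Orthogonality of the Hermite polynomials under the standard normal law. -/
lemma integral_hermiteR_mul_hermiteR (m n : ℕ) :
    ∫ x, (hermiteR m).eval x * (hermiteR n).eval x ∂(gaussianReal 0 1)
      = if m = n then (n.factorial : ℝ) else 0 := by
  induction m generalizing n with
  | zero =>
    cases n with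
    | zero => simp [hermiteR_zero]
    | succ n =>
      have := integral_hermiteR_succ_mul n (hermiteR 0)
      simp only [mul_comm] at this ⊢
      rw [this]; simp [hermiteR_zero]
  | succ m ih =>
    cases n with
    | zero => rw [integral_hermiteR_succ_mul]; simp [hermiteR_zero]
    | succ n =>
      rw [integral_hermiteR_succ_mul, derivative_hermiteR_succ]
      have := ih n
      simp only [eval_mul, eval_add, eval_natCast, eval_one] 
      simp_rw [mul_left_comm _ ((n : ℝ) + 1) _]
      rw [integral_const_mul, this]
      by_cases hmn : m = n <;> simp [hmn, Nat.factorial_succ]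

/-- The Ornstein–Uhlenbeck action on Hermite polynomials. -/
lemma integral_hermiteR_affine {ρ : ℝ} (hρ : ρ ^ 2 ≤ 1) (n : ℕ) (x : ℝ) :
    ∫ w, (hermiteR n).eval (ρ * x + w) ∂(gaussianReal 0 (1 - ρ ^ 2).toNNReal)
      = ρ ^ n * (hermiteR n).eval x := by
  set v := (1 - ρ ^ 2).toNNReal with hv
  have hvc : (v : ℝ) = 1 - ρ ^ 2 := Real.coe_toNNReal _ (by linarith)
  have hev : ∀ (R : ℝ[X]) w, R.eval (ρ * x + w) = (R.comp (C (ρ * x) + X)).eval w := by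
    intro R w; simp [eval_comp]
  have hint : ∀ R : ℝ[X], Integrable (fun w => R.eval (ρ * x + w)) (gaussianReal 0 v) := by
    intro R; simp_rw [hev]; exact integrable_eval_gaussianReal _ _ _
  have hibp : ∀ R : ℝ[X], ∫ w, w * R.eval (ρ * x + w) ∂(gaussianReal 0 v)
      = v * ∫ w, (derivative R).eval (ρ * x + w) ∂(gaussianReal 0 v) := by
    intro R
    simp_rw [hev]
    rw [integral_mul_eval_gaussianReal]
    simp [derivative_comp]
  have hintm : ∀ R : ℝ[X], Integrable (fun w => w * R.eval (ρ * x + w)) (gaussianReal 0 v) := by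
    intro R; simp_rw [hev]
    have := integrable_eval_gaussianReal (X * (R.comp (C (ρ * x) + X))) 0 v
    simpa only [eval_mul, eval_X] using this
  induction n using Nat.twoStepInduction with
  | zero => simp [hermiteR_zero]
  | one =>
    have h0 := hibp 1
    simp only [eval_one, derivative_one, eval_zero, mul_one, integral_zero, mul_zero] at h0
    have : hermiteR 1 = X := by simp [hermiteR_succ, hermiteR_zero]
    have h1 : Integrable (fun w : ℝ => w) (gaussianReal 0 v) := by simpa using hintm 1
    simp only [this, eval_X, pow_one]
    rw [integral_add (integrable_const _) h1, h0]
    simp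
  -- Integrating the term with factor `w` by parts yields `(1 - ρ²)(n + 1) ρ^n H_n(x)`. Its leading
  -- part cancels the last term of the recurrence and leaves `-(n + 1) ρ^(n+2) H_n(x)`.
  | more n ih1 ih2 =>
    rw [hermiteR_succ_succ]
    have e : ∀ w, (X * hermiteR (n + 1) - (n + 1 : ℝ[X]) * hermiteR n).eval (ρ * x + w)
        = ρ * x * (hermiteR (n + 1)).eval (ρ * x + w) + w * (hermiteR (n + 1)).eval (ρ * x + w)
          - (n + 1) * (hermiteR n).eval (ρ * x + w) := by
      intro w; simp only [eval_sub, eval_mul, eval_X, eval_add, eval_natCast, eval_one]; ring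
    simp_rw [e]
    have hsum : Integrable (fun w => ρ * x * (hermiteR (n + 1)).eval (ρ * x + w)
        + w * (hermiteR (n + 1)).eval (ρ * x + w)) (gaussianReal 0 v) :=
      ((hint _).const_mul _).add (hintm _)
    rw [integral_sub hsum ((hint _).const_mul _),
      integral_add ((hint _).const_mul _) (hintm _), hibp, integral_const_mul, integral_const_mul,
      ih1, ih2, derivative_hermiteR_succ]
    simp only [eval_mul, eval_add, eval_natCast, eval_one, eval_sub, eval_X]
    rw [integral_const_mul, ih1, hvc]
    ring

end GaussianReduction

namespace GaussianReduction

open Polynomial NNReal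

/-! ### Correlated pairs of standard Gaussian vectors -/

section Real

variable {Ω : Type*} [MeasurableSpace Ω] {P : Measure Ω}

lemma memLp_two_eval_comp {X : Ω → ℝ} (hX : AEMeasurable X P) (hlaw : P.map X = gaussianReal 0 1)
    (Q : ℝ[X]) : MemLp (fun ω => Q.eval (X ω)) 2 P := by
  have h : MemLp (fun x : ℝ => Q.eval x) 2 (P.map X) := by
    rw [hlaw, memLp_two_iff_integrable_sq (by fun_prop)]
    simp_rw [← Polynomial.eval_pow]
    exact integrable_eval_gaussianReal (Q ^ 2) 0 1
  exact h.comp_of_map hX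

/-- Mehler's formula for two jointly Gaussian standard normal variables. -/
lemma integral_hermiteR_comp_mul [IsProbabilityMeasure P] {X Y : Ω → ℝ} {ρ : ℝ}
    (hXY : HasGaussianLaw (fun ω => (X ω, Y ω)) P)
    (hX : ∫ ω, X ω ∂P = 0) (hY : ∫ ω, Y ω ∂P = 0) (hvX : Var[X; P] = 1) (hvY : Var[Y; P] = 1)
    (hcov : cov[X, Y; P] = ρ) (m n : ℕ) :
    ∫ ω, (hermiteR m).eval (X ω) * (hermiteR n).eval (Y ω) ∂P
      = if m = n then (n.factorial : ℝ) * ρ ^ n else 0 := by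
  have hXg := hXY.fst
  have hYg := hXY.snd
  have hX2 := hXg.memLp_two
  have hY2 := hYg.memLp_two
  -- The regression residual: uncorrelated with `X`, hence independent of it by joint Gaussianity,
  -- with variance `1 - ρ²`. Integrating it out first reduces the claim to
  -- `integral_hermiteR_affine`.
  set W : Ω → ℝ := fun ω => Y ω - ρ * X ω with hW
  have hXW : HasGaussianLaw (fun ω => (X ω, W ω)) P := by
    exact hXY.map ((ContinuousLinearMap.fst ℝ ℝ ℝ).prod
      (ContinuousLinearMap.snd ℝ ℝ ℝ - ρ • ContinuousLinearMap.fst ℝ ℝ ℝ))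
  have hcW : cov[X, W; P] = 0 := by
    rw [hW, covariance_fun_sub_right hX2 hY2 (hX2.const_mul ρ), covariance_const_mul_right,
      covariance_self hXg.aemeasurable, hvX, hcov]; ring
  have hind : X ⟂ᵢ[P] W := hXW.indepFun_of_covariance_eq_zero hcW
  have hvW : Var[W; P] = 1 - ρ ^ 2 := by
    rw [hW, variance_fun_sub hY2 (hX2.const_mul ρ), covariance_const_mul_right, covariance_comm,
      hcov, variance_const_mul, hvX, hvY]; ring
  have hmW : ∫ ω, W ω ∂P = 0 := by
    rw [hW, integral_sub hYg.integrable (hXg.integrable.const_mul ρ), integral_const_mul, hX, hY]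
    simp
  have hρ : ρ ^ 2 ≤ 1 := by linarith [hvW ▸ variance_nonneg W P]
  have hlX : P.map X = gaussianReal 0 1 := by
    rw [hXg.map_eq_gaussianReal, hX, hvX]; simp
  have hlY : P.map Y = gaussianReal 0 1 := by
    rw [hYg.map_eq_gaussianReal, hY, hvY]; simp
  have hlW : P.map W = gaussianReal 0 (1 - ρ ^ 2).toNNReal := by
    rw [hXW.snd.map_eq_gaussianReal, hmW, hvW]
  have hlaw : P.map (fun ω => (X ω, W ω))
      = (gaussianReal 0 1).prod (gaussianReal 0 (1 - ρ ^ 2).toNNReal) := by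
    rw [hind.map_prod_eq_prod_map_map hXg.aemeasurable hXW.snd.aemeasurable, hlX, hlW]
  have hY' : ∀ ω, Y ω = ρ * X ω + W ω := fun ω => by simp [hW]
  set f : ℝ × ℝ → ℝ := fun q => (hermiteR m).eval q.1 * (hermiteR n).eval (ρ * q.1 + q.2) with hf
  have hfc : Continuous f := by fun_prop
  have hint : Integrable f (P.map (fun ω => (X ω, W ω))) := by
    rw [integrable_map_measure hfc.aestronglyMeasurable hXW.aemeasurable]
    have := (memLp_two_eval_comp hXg.aemeasurable hlX (hermiteR m)).integrable_mul
      (memLp_two_eval_comp hYg.aemeasurable hlY (hermiteR n))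
    refine this.congr (ae_of_all _ fun ω => ?_)
    simp [hf, hY' ω]
  have : ∫ ω, (hermiteR m).eval (X ω) * (hermiteR n).eval (Y ω) ∂P
      = ∫ q, f q ∂(P.map (fun ω => (X ω, W ω))) := by
    rw [integral_map hXW.aemeasurable hfc.aestronglyMeasurable]
    simp [hf, hY']
  rw [this]
  rw [hlaw] at hint ⊢
  rw [integral_prod _ hint]
  simp only [hf, integral_const_mul, integral_hermiteR_affine hρ]
  simp_rw [mul_left_comm _ (ρ ^ n) _]
  rw [integral_const_mul, integral_hermiteR_mul_hermiteR]
  split_ifs <;> ring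

end Real

variable {p : ℕ} {Ω : Type*} [MeasurableSpace Ω] {P : Measure Ω}

/-- `X` and `Y` are jointly Gaussian standard normal vectors with cross-covariance matrix
`ρ • 1`. -/
structure IsCorrelatedPair (X Y : Ω → Fin p → ℝ) (ρ : ℝ) (P : Measure Ω) : Prop where
  measurable_left : Measurable X
  measurable_right : Measurable Y
  gaussian : HasGaussianLaw (fun ω => (X ω, Y ω)) P
  mean_left : ∀ i, ∫ ω, X ω i ∂P = 0
  mean_right : ∀ i, ∫ ω, Y ω i ∂P = 0
  cov_left : ∀ i j, cov[fun ω => X ω i, fun ω => X ω j; P] = (1 : Matrix (Fin p) (Fin p) ℝ) i j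
  cov_right : ∀ i j, cov[fun ω => Y ω i, fun ω => Y ω j; P] = (1 : Matrix (Fin p) (Fin p) ℝ) i j
  cov_cross : ∀ i j,
    cov[fun ω => X ω i, fun ω => Y ω j; P] = (1 : Matrix (Fin p) (Fin p) ℝ) i j * ρ

instance : IsProbabilityMeasure (stdGauss p) := by unfold stdGauss; infer_instance

namespace IsCorrelatedPair

variable {X Y : Ω → Fin p → ℝ} {ρ : ℝ}

lemma symm (h : IsCorrelatedPair X Y ρ P) : IsCorrelatedPair Y X ρ P where
  measurable_left := h.measurable_right
  measurable_right := h.measurable_left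
  gaussian := h.gaussian.map ((ContinuousLinearMap.snd ℝ _ _).prod (ContinuousLinearMap.fst ℝ _ _))
  mean_left := h.mean_right
  mean_right := h.mean_left
  cov_left := h.cov_right
  cov_right := h.cov_left
  cov_cross i j := by
    rw [covariance_comm, h.cov_cross, Matrix.one_apply, Matrix.one_apply]; simp [eq_comm]

lemma measurePreserving_left [IsProbabilityMeasure P] (h : IsCorrelatedPair X Y ρ P) :
    MeasurePreserving X P (stdGauss p) := by
  refine ⟨h.measurable_left, ?_⟩
  have hg : HasGaussianLaw (fun ω i => X ω i) P := h.gaussian.fst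
  have hind : iIndepFun (fun i ω => X ω i) P := by
    refine hg.iIndepFun_of_covariance_eq_zero (X := fun i ω => X ω i) fun i j hij => ?_
    rw [h.cov_left, Matrix.one_apply_ne hij]
  have hm : ∀ i, Measurable fun ω => X ω i := fun i => (measurable_pi_apply i).comp h.measurable_left
  have := hind.map_fun_eq_pi_map (fun i => (hm i).aemeasurable)
  change P.map (fun ω i => X ω i) = _
  rw [this, stdGauss]
  congr 1; ext1 i
  have hgi : HasGaussianLaw (fun ω => X ω i) P := hg.map (ContinuousLinearMap.proj i)
  rw [hgi.map_eq_gaussianReal, h.mean_left, ← covariance_self (hm i).aemeasurable, h.cov_left]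
  simp

lemma measurePreserving_right [IsProbabilityMeasure P] (h : IsCorrelatedPair X Y ρ P) :
    MeasurePreserving Y P (stdGauss p) := h.symm.measurePreserving_left

lemma hasGaussianLaw_coord (h : IsCorrelatedPair X Y ρ P) (i : Fin p) :
    HasGaussianLaw (fun ω => (X ω i, Y ω i)) P :=
  h.gaussian.map ((ContinuousLinearMap.proj (R := ℝ) (φ := fun _ : Fin p => ℝ) i).prodMap
    (ContinuousLinearMap.proj (R := ℝ) (φ := fun _ : Fin p => ℝ) i))

lemma measurable_left_apply (h : IsCorrelatedPair X Y ρ P) (i : Fin p) :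
    Measurable fun ω => X ω i := (measurable_pi_apply i).comp h.measurable_left

lemma measurable_right_apply (h : IsCorrelatedPair X Y ρ P) (i : Fin p) :
    Measurable fun ω => Y ω i := (measurable_pi_apply i).comp h.measurable_right

lemma variance_left (h : IsCorrelatedPair X Y ρ P) (i : Fin p) : Var[fun ω => X ω i; P] = 1 := by
  rw [← covariance_self (h.measurable_left_apply i).aemeasurable, h.cov_left, Matrix.one_apply_eq]

lemma variance_right (h : IsCorrelatedPair X Y ρ P) (i : Fin p) : Var[fun ω => Y ω i; P] = 1 :=
  h.symm.variance_left i

/-- The variance of `Y_i - ρ X_i` equals `1 - ρ²`; a coordinate must exist, whence `0 < p`. -/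
lemma abs_corr_le_one [IsProbabilityMeasure P] (h : IsCorrelatedPair X Y ρ P) (hp : 0 < p) :
    |ρ| ≤ 1 := by
  let i : Fin p := ⟨0, hp⟩
  have hX := (h.hasGaussianLaw_coord i).fst.memLp_two
  have hY := (h.hasGaussianLaw_coord i).snd.memLp_two
  have hc : cov[fun ω => X ω i, fun ω => Y ω i; P] = ρ := by simp [h.cov_cross]
  have h1 := variance_nonneg (fun ω => Y ω i - ρ * X ω i) P
  rw [variance_fun_sub hY (hX.const_mul ρ), covariance_const_mul_right, covariance_comm,
      hc, variance_const_mul, h.variance_left, h.variance_right] at h1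
  rw [← sq_le_one_iff_abs_le_one]
  linarith

/-- Mehler's formula for products of Hermite polynomials. -/
lemma integral_hermiteProd_mul [IsProbabilityMeasure P] (h : IsCorrelatedPair X Y ρ P)
    (ν μ : Fin p → ℕ) :
    ∫ ω, hermiteProd ν (X ω) * hermiteProd μ (Y ω) ∂P
      = if ν = μ then (multiFactorial ν : ℝ) * ρ ^ (∑ j, ν j) else 0 := by
  -- Regrouping by coordinate: the pairs `(X_i, Y_i)` are independent for different `i`, so the
  -- expectation factors into one-dimensional Mehler formulas.
  let Z : (i : Fin p) → Fin 2 → Ω → ℝ := fun i => ![fun ω => X ω i, fun ω => Y ω i]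
  let A : (Fin p → ℝ) × (Fin p → ℝ) →L[ℝ] (Fin p → Fin 2 → ℝ) :=
    ContinuousLinearMap.pi fun i => ContinuousLinearMap.pi
      ![(ContinuousLinearMap.proj i) ∘L (ContinuousLinearMap.fst ℝ _ _),
        (ContinuousLinearMap.proj i) ∘L (ContinuousLinearMap.snd ℝ _ _)]
  have hZ : HasGaussianLaw (fun ω i j => Z i j ω) P := by
    convert! h.gaussian.map A using 1
    ext ω i j
    fin_cases j <;> simp [Z, A]
  have hZm : ∀ i, AEMeasurable (fun ω j => Z i j ω) P := by
    intro i
    refine aemeasurable_pi_lambda _ fun j => ?_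
    fin_cases j
    · exact (h.measurable_left_apply i).aemeasurable
    · exact (h.measurable_right_apply i).aemeasurable
  have hind : iIndepFun (fun i ω j => Z i j ω) P := by
    refine hZ.iIndepFun_of_covariance_eval fun i j hij k l => ?_
    fin_cases k <;> fin_cases l
    · simpa [Z, Matrix.one_apply_ne hij] using h.cov_left i j
    · simpa [Z, Matrix.one_apply_ne hij] using h.cov_cross i j
    · simpa [Z, Matrix.one_apply_ne hij] using h.symm.cov_cross i j
    · simpa [Z, Matrix.one_apply_ne hij] using h.cov_right i j
  have key := hind.integral_fun_prod_comp hZm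
    (f := fun i z => (hermiteR (ν i)).eval (z 0) * (hermiteR (μ i)).eval (z 1))
    (fun i => Continuous.aestronglyMeasurable (by fun_prop))
  have e : ∀ ω, hermiteProd ν (X ω) * hermiteProd μ (Y ω)
      = ∏ i, ((hermiteR (ν i)).eval (Z i 0 ω) * (hermiteR (μ i)).eval (Z i 1 ω)) := by
    intro ω
    simp [hermiteProd, aeval_hermite_eq, Finset.prod_mul_distrib, Z]
  simp_rw [e]
  rw [key]
  have e2 : ∀ i, ∫ ω, (hermiteR (ν i)).eval (Z i 0 ω) * (hermiteR (μ i)).eval (Z i 1 ω) ∂P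
      = if ν i = μ i then ((μ i).factorial : ℝ) * ρ ^ (μ i) else 0 := fun i =>
    integral_hermiteR_comp_mul (h.hasGaussianLaw_coord i) (h.mean_left i) (h.mean_right i)
      (h.variance_left i) (h.variance_right i) (by simp [h.cov_cross]) _ _
  simp_rw [e2]
  by_cases hνμ : ν = μ
  · subst hνμ
    simp [multiFactorial, Finset.prod_mul_distrib, Finset.prod_pow_eq_pow_sum]
  · rw [if_neg hνμ]
    obtain ⟨i, hi⟩ := Function.ne_iff.1 hνμ
    exact Finset.prod_eq_zero (Finset.mem_univ i) (by simp [hi])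

end IsCorrelatedPair

/-! ### The orthonormal Hermite basis -/

lemma multiFactorial_pos (ν : Fin p → ℕ) : (0 : ℝ) < multiFactorial ν := by
  unfold multiFactorial
  exact_mod_cast Finset.prod_pos fun j _ => Nat.factorial_pos _

lemma integral_hermiteProd_mul_stdGauss (ν μ : Fin p → ℕ) :
    ∫ w, hermiteProd ν w * hermiteProd μ w ∂(stdGauss p)
      = if ν = μ then (multiFactorial ν : ℝ) else 0 := by
  unfold stdGauss hermiteProd
  simp_rw [aeval_hermite_eq, ← Finset.prod_mul_distrib]
  rw [integral_fintype_prod_eq_prod (f := fun i x =>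
    (hermiteR (ν i)).eval x * (hermiteR (μ i)).eval x)]
  simp_rw [integral_hermiteR_mul_hermiteR]
  by_cases hνμ : ν = μ
  · subst hνμ; simp [multiFactorial]
  · rw [if_neg hνμ]
    obtain ⟨i, hi⟩ := Function.ne_iff.1 hνμ
    exact Finset.prod_eq_zero (Finset.mem_univ i) (by simp [hi])

lemma memLp_prod_eval_stdGauss (Q : Fin p → ℝ[X]) :
    MemLp (fun w : Fin p → ℝ => ∏ i, (Q i).eval (w i)) 2 (stdGauss p) := by
  rw [memLp_two_iff_integrable_sq (Continuous.aestronglyMeasurable (by fun_prop))]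
  simp_rw [← Finset.prod_pow]
  refine Integrable.fintype_prod (f := fun i x => (Q i).eval x ^ 2) fun i => ?_
  simp_rw [← Polynomial.eval_pow]
  exact integrable_eval_gaussianReal (Q i ^ 2) 0 1

lemma memLp_hermiteProd (ν : Fin p → ℕ) : MemLp (hermiteProd ν) 2 (stdGauss p) := by
  have := memLp_prod_eval_stdGauss fun i => hermiteR (ν i)
  unfold hermiteProd
  simpa only [aeval_hermite_eq] using this

end GaussianReduction

namespace GaussianReduction

open Polynomial NNReal

variable {p : ℕ}

/-! ### Completeness of the Hermite system -/

/-- The `H_n` span all polynomials, having degree `n` and leading coefficient 1. Orthogonality is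
extended by linearity in one coordinate at a time; `s` collects the coordinates whose factor is
already arbitrary. -/
lemma integral_mul_prod_eval_eq_zero {F : (Fin p → ℝ) → ℝ} (hF : MemLp F 2 (stdGauss p))
    (h : ∀ ν : Fin p → ℕ, ∫ w, F w * hermiteProd ν w ∂(stdGauss p) = 0) (Q : Fin p → ℝ[X]) :
    ∫ w, F w * ∏ i, (Q i).eval (w i) ∂(stdGauss p) = 0 := by
  have hint : ∀ Q : Fin p → ℝ[X], Integrable (fun w => F w * ∏ i, (Q i).eval (w i)) (stdGauss p) :=
    fun Q => hF.integrable_mul (memLp_prod_eval_stdGauss Q)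
  let S : Polynomial.Sequence ℝ := ⟨hermiteR, fun n => by
    rw [hermiteR, degree_map_eq_of_injective Int.cast_injective, degree_hermite]⟩
  have hS : Submodule.span ℝ (Set.range hermiteR) = ⊤ := S.span fun n => by
    have : (hermiteR n).leadingCoeff = 1 := ((hermite_monic n).map _).leadingCoeff
    change IsUnit (hermiteR n).leadingCoeff
    simp [this]
  suffices H : ∀ (s : Finset (Fin p)) (Q : Fin p → ℝ[X]),
      (∀ i ∉ s, Q i ∈ Set.range hermiteR) → ∫ w, F w * ∏ i, (Q i).eval (w i) ∂(stdGauss p) = 0 from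
    H Finset.univ Q (by simp)
  intro s
  induction s using Finset.induction_on with
  | empty =>
    intro Q hQ
    choose ν hν using fun i => hQ i (Finset.notMem_empty i)
    simpa [hermiteProd, aeval_hermite_eq, hν] using h ν
  | insert a s ha ih =>
    intro Q hQ
    have key : ∀ R ∈ Submodule.span ℝ (Set.range hermiteR),
        ∫ w, F w * ∏ i, (Function.update Q a R i).eval (w i) ∂(stdGauss p) = 0 := by
      have hupd : ∀ (R : ℝ[X]) (w : Fin p → ℝ), ∏ i, (Function.update Q a R i).eval (w i)
          = R.eval (w a) * ∏ i ∈ Finset.univ.erase a, (Q i).eval (w i) := by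
        intro R w
        rw [← Finset.mul_prod_erase _ _ (Finset.mem_univ a), Function.update_self]
        congr 1
        refine Finset.prod_congr rfl fun i hi => ?_
        rw [Function.update_of_ne (Finset.ne_of_mem_erase hi)]
      intro R hR
      induction hR using Submodule.span_induction with
      | mem R hR =>
        refine ih _ fun i hi => ?_
        by_cases hia : i = a
        · subst hia; simpa using hR
        · rw [Function.update_of_ne hia]
          exact hQ i (by simp [hia, hi])
      | zero => simp [hupd]
      | add R T _ _ hR hT =>
        have e : ∀ w, F w * ∏ i, (Function.update Q a (R + T) i).eval (w i)
            = F w * ∏ i, (Function.update Q a R i).eval (w i)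
              + F w * ∏ i, (Function.update Q a T i).eval (w i) := by
          intro w; simp only [hupd, eval_add]; ring
        simp_rw [e]
        rw [integral_add (hint _) (hint _), hR, hT, add_zero]
      | smul c R _ hR =>
        have e : ∀ w, F w * ∏ i, (Function.update Q a (c • R) i).eval (w i)
            = c * (F w * ∏ i, (Function.update Q a R i).eval (w i)) := by
          intro w; simp only [hupd, eval_smul, smul_eq_mul]; ring
        simp_rw [e]
        rw [integral_const_mul, hR, mul_zero]
    simpa using key (Q a) (by rw [hS]; trivial)

lemma integral_mul_linear_pow_eq_zero {F : (Fin p → ℝ) → ℝ} (hF : MemLp F 2 (stdGauss p))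
    (h : ∀ ν : Fin p → ℕ, ∫ w, F w * hermiteProd ν w ∂(stdGauss p) = 0) (t : Fin p → ℝ) (n : ℕ) :
    ∫ w, F w * (∑ i, t i * w i) ^ n ∂(stdGauss p) = 0 := by
  simp_rw [Finset.sum_pow_eq_sum_piAntidiag, Finset.mul_sum]
  have e : ∀ (k : Fin p → ℕ) (w : Fin p → ℝ),
      F w * ((Nat.multinomial Finset.univ k : ℝ) * ∏ i, (t i * w i) ^ k i)
        = (Nat.multinomial Finset.univ k : ℝ) *
          (F w * ∏ i, ((C (t i) * X) ^ k i : ℝ[X]).eval (w i)) := by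
    intro k w; simp only [eval_pow, eval_mul, eval_C, eval_X]; ring
  simp_rw [e]
  rw [integral_finsetSum _ fun k _ =>
    (hF.integrable_mul (memLp_prod_eval_stdGauss fun i => (C (t i) * X) ^ k i)).const_mul _]
  refine Finset.sum_eq_zero fun k _ => ?_
  rw [integral_const_mul, integral_mul_prod_eval_eq_zero hF h, mul_zero]

lemma memLp_exp_linear (t : Fin p → ℝ) :
    MemLp (fun w : Fin p → ℝ => Real.exp (∑ i, t i * w i)) 2 (stdGauss p) := by
  rw [memLp_two_iff_integrable_sq (Continuous.aestronglyMeasurable (by fun_prop))]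
  have e : ∀ w : Fin p → ℝ, Real.exp (∑ i, t i * w i) ^ 2 = ∏ i, Real.exp (2 * t i * w i) := by
    intro w
    rw [← Real.exp_sum, ← Real.exp_nat_mul, Finset.mul_sum]
    simp [mul_assoc]
  simp_rw [e]
  exact Integrable.fintype_prod (f := fun i x => Real.exp (2 * t i * x)) fun i =>
    integrable_exp_mul_gaussianReal _

/-- Each term of the power series of the exponential integrates to 0 by the multinomial theorem.
Termwise integration is justified by the bound `|F| e^|s| ≤ |F| (e^s + e^(-s))`, a product of square
integrable functions. -/
lemma integral_mul_cexp_eq_zero {F : (Fin p → ℝ) → ℝ} (hF : MemLp F 2 (stdGauss p))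
    (h : ∀ ν : Fin p → ℕ, ∫ w, F w * hermiteProd ν w ∂(stdGauss p) = 0) (t : Fin p → ℝ) :
    ∫ w, (F w : ℂ) * Complex.exp ((∑ i, t i * w i : ℝ) * Complex.I) ∂(stdGauss p) = 0 := by
  set s : (Fin p → ℝ) → ℝ := fun w => ∑ i, t i * w i with hs
  have hsc : Continuous s := by fun_prop
  have hFm := hF.aestronglyMeasurable
  have hbint : Integrable (fun w => |F w| * Real.exp |s w|) (stdGauss p) := by
    have h1 := hF.norm.integrable_mul (memLp_exp_linear t)
    have h2 := hF.norm.integrable_mul (memLp_exp_linear (-t))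
    refine (h1.add h2).mono' ?_ (ae_of_all _ fun w => ?_)
    · exact (hFm.norm).mul (Continuous.aestronglyMeasurable (by fun_prop))
    · have : Real.exp |s w| ≤ Real.exp (s w) + Real.exp (-(s w)) := by
        rcases abs_cases (s w) with ⟨h, _⟩ | ⟨h, _⟩ <;> rw [h] <;>
          nlinarith [Real.exp_pos (s w), Real.exp_pos (-(s w))]
      have h3 : ∑ i, (-t) i * w i = -(s w) := by simp [hs]
      simp only [Pi.add_apply, Pi.mul_apply, h3, norm_mul, Real.norm_eq_abs, abs_abs, Real.abs_exp]
      rw [← mul_add]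
      exact mul_le_mul_of_nonneg_left this (abs_nonneg _)
  have key := hasSum_integral_of_dominated_convergence (μ := stdGauss p)
    (F := fun n w => (F w : ℂ) * (((s w : ℂ) * Complex.I) ^ n / n.factorial))
    (f := fun w => (F w : ℂ) * Complex.exp ((s w : ℂ) * Complex.I))
    (fun n w => |F w| * (|s w| ^ n / n.factorial)) ?_ ?_ ?_ ?_ ?_
  · have hz : ∀ n : ℕ, ∫ w, (F w : ℂ) * (((s w : ℂ) * Complex.I) ^ n / n.factorial) ∂(stdGauss p)
        = 0 := by
      intro n
      have e : ∀ w, (F w : ℂ) * (((s w : ℂ) * Complex.I) ^ n / n.factorial)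
          = (Complex.I ^ n / n.factorial) * ((F w * s w ^ n : ℝ) : ℂ) := by
        intro w; push_cast; ring
      simp_rw [e]
      rw [integral_const_mul, integral_complex_ofReal, integral_mul_linear_pow_eq_zero hF h]
      simp
    simp_rw [hz] at key
    exact (hasSum_zero.unique key).symm
  · intro n
    exact (Complex.continuous_ofReal.comp_aestronglyMeasurable hFm).mul
      (Continuous.aestronglyMeasurable (by fun_prop))
  · intro n
    refine ae_of_all _ fun w => ?_
    simp
  · exact ae_of_all _ fun w => (Real.summable_pow_div_factorial _).mul_left _
  · refine hbint.congr (ae_of_all _ fun w => ?_)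
    simp only
    rw [Real.exp_eq_exp_ℝ]
    exact ((NormedSpace.expSeries_div_hasSum_exp (𝔸 := ℝ) |s w|).mul_left |F w|).tsum_eq.symm
  · refine ae_of_all _ fun w => ?_
    rw [Complex.exp_eq_exp_ℂ]
    exact (NormedSpace.expSeries_div_hasSum_exp (𝔸 := ℂ) ((s w : ℂ) * Complex.I)).mul_left (F w : ℂ)

/-- A square integrable function orthogonal to all Hermite products vanishes almost everywhere. -/
theorem ae_eq_zero_of_hermiteCoeff_eq_zero {F : (Fin p → ℝ) → ℝ} (hF : MemLp F 2 (stdGauss p))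
    (h : ∀ ν : Fin p → ℕ, hermiteCoeff F ν = 0) : F =ᵐ[stdGauss p] 0 := by
  have hFi : Integrable F (stdGauss p) := hF.integrable (by norm_num)
  have hFm : AEMeasurable F (stdGauss p) := hFi.aemeasurable
  -- The positive and negative parts of `F` define finite measures. The vanishing Fourier transform
  -- makes their characteristic functions agree, so the measures coincide and both densities vanish.
  let μ₁ := (stdGauss p).withDensity fun w => ENNReal.ofReal (F w)
  let μ₂ := (stdGauss p).withDensity fun w => ENNReal.ofReal (-F w)
  have : IsFiniteMeasure μ₁ := isFiniteMeasure_withDensity_ofReal hFi.2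
  have : IsFiniteMeasure μ₂ := isFiniteMeasure_withDensity_ofReal hFi.neg.2
  have hμ : μ₁ = μ₂ := by
    refine Measure.ext_of_charFunDual ?_
    ext L
    have hL : ∀ w : Fin p → ℝ, L w = ∑ i, L (Pi.single i 1) * w i := by
      intro w
      conv_lhs => rw [← Finset.univ_sum_single w]
      rw [map_sum]
      refine Finset.sum_congr rfl fun i _ => ?_
      have : (Pi.single i (w i) : Fin p → ℝ) = w i • Pi.single i 1 := by
        rw [← Pi.single_smul]; simp
      rw [this, map_smul, smul_eq_mul, mul_comm]
    set g : (Fin p → ℝ) → ℂ := fun w => Complex.exp (L w * Complex.I) with hg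
    have hgn : ∀ w, ‖g w‖ = 1 := fun w => Complex.norm_exp_ofReal_mul_I _
    have hgm : AEStronglyMeasurable g (stdGauss p) :=
      Continuous.aestronglyMeasurable (by fun_prop)
    have hz : ∫ w, (F w : ℂ) * g w ∂(stdGauss p) = 0 := by
      have := integral_mul_cexp_eq_zero hF h (fun i => L (Pi.single i 1))
      simp_rw [← hL] at this
      exact this
    have hwd : ∀ f : (Fin p → ℝ) → ℝ, Integrable f (stdGauss p) →
        ∫ w, g w ∂((stdGauss p).withDensity fun w => ENNReal.ofReal (f w))
          = ∫ w, ((max (f w) 0 : ℝ) : ℂ) * g w ∂(stdGauss p) := by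
      intro f hf
      rw [integral_withDensity_eq_integral_toReal_smul₀ hf.aemeasurable.ennreal_ofReal
        (ae_of_all _ fun _ => ENNReal.ofReal_lt_top)]
      simp only [ENNReal.toReal_ofReal', Complex.real_smul]
    have hmi : ∀ f : (Fin p → ℝ) → ℝ, Integrable f (stdGauss p) →
        Integrable (fun w => ((max (f w) 0 : ℝ) : ℂ) * g w) (stdGauss p) := by
      intro f hf
      refine (hf.pos_part.ofReal (𝕜 := ℂ)).mul_bdd (c := 1) hgm (ae_of_all _ fun w => (hgn w).le)
    rw [charFunDual_apply, charFunDual_apply]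
    change ∫ w, g w ∂μ₁ = ∫ w, g w ∂μ₂
    rw [hwd F hFi, hwd (fun w => -F w) hFi.neg, ← sub_eq_zero, ← integral_sub (hmi _ hFi)
      (hmi (fun w => -F w) hFi.neg), ← hz]
    congr 1; ext w
    rw [← sub_mul, ← Complex.ofReal_sub]
    congr 2
    rcases le_total 0 (F w) with h0 | h0
    · rw [max_eq_left h0, max_eq_right (by linarith)]; ring
    · rw [max_eq_right h0, max_eq_left (by linarith)]; ring
  have hae := (withDensity_eq_iff hFm.ennreal_ofReal hFm.neg.ennreal_ofReal
    (by
      have := measure_ne_top μ₁ Set.univ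
      simpa [μ₁] using this)).1 hμ
  filter_upwards [hae] with w hw
  rcases le_total 0 (F w) with h0 | h0
  · have : ENNReal.ofReal (-F w) = 0 := ENNReal.ofReal_eq_zero.2 (by linarith)
    have h1 : ENNReal.ofReal (F w) = 0 := hw.trans this
    exact le_antisymm (ENNReal.ofReal_eq_zero.1 h1) h0
  · have : ENNReal.ofReal (F w) = 0 := ENNReal.ofReal_eq_zero.2 h0
    have h1 : ENNReal.ofReal (-F w) = 0 := hw.symm.trans this
    have := ENNReal.ofReal_eq_zero.1 h1
    simp only [Pi.zero_apply]; linarith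

end GaussianReduction

namespace GaussianReduction

variable {p : ℕ}

/-! ### The Hermite basis and Mehler's formula in `L²` -/

/-- The normalized Hermite product `e_ν / √ν!` as an element of `L²` of the Gaussian measure. -/
noncomputable def hermiteVec (ν : Fin p → ℕ) : Lp ℝ 2 (stdGauss p) :=
  (√(multiFactorial ν : ℝ))⁻¹ • (memLp_hermiteProd ν).toLp

lemma inner_toLp_toLp {α : Type*} [MeasurableSpace α] {μ : Measure α} {f g : α → ℝ}
    (hf : MemLp f 2 μ) (hg : MemLp g 2 μ) :
    inner ℝ hf.toLp hg.toLp = ∫ a, f a * g a ∂μ := by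
  rw [L2.inner_def]
  refine integral_congr_ae ?_
  filter_upwards [hf.coeFn_toLp, hg.coeFn_toLp] with a h1 h2
  simp [h1, h2, mul_comm]

lemma inner_hermiteVec_toLp {G : (Fin p → ℝ) → ℝ} (hG : MemLp G 2 (stdGauss p))
    (ν : Fin p → ℕ) :
    inner ℝ (hermiteVec ν) hG.toLp = (√(multiFactorial ν : ℝ))⁻¹ * hermiteCoeff G ν := by
  rw [hermiteVec, real_inner_smul_left, inner_toLp_toLp]
  simp_rw [hermiteCoeff, mul_comm]

lemma orthonormal_hermiteVec : Orthonormal ℝ (hermiteVec (p := p)) := by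
  rw [orthonormal_iff_ite]
  intro ν μ
  rw [hermiteVec, hermiteVec, real_inner_smul_left, real_inner_smul_right, inner_toLp_toLp,
    integral_hermiteProd_mul_stdGauss]
  split_ifs with h
  · subst h
    have := multiFactorial_pos ν
    rw [← mul_assoc, ← mul_inv, Real.mul_self_sqrt this.le, inv_mul_cancel₀ this.ne']
  · simp

/-- The normalized Hermite products form a Hilbert basis of `L²(ℝᵖ, φ)`. -/
noncomputable def hermiteBasis (p : ℕ) : HilbertBasis (Fin p → ℕ) ℝ (Lp ℝ 2 (stdGauss p)) :=
  HilbertBasis.mkOfOrthogonalEqBot orthonormal_hermiteVec (by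
    rw [Submodule.eq_bot_iff]
    intro F hF
    have hF' : MemLp F 2 (stdGauss p) := Lp.memLp F
    have h0 : ∀ ν : Fin p → ℕ, hermiteCoeff F ν = 0 := by
      intro ν
      have h1 : inner ℝ (hermiteVec ν) F = 0 :=
        (Submodule.mem_orthogonal _ _).1 hF _ (Submodule.subset_span ⟨ν, rfl⟩)
      have h2 := inner_hermiteVec_toLp hF' ν
      rw [Lp.toLp_coeFn, h1] at h2
      have := (Real.sqrt_pos.2 (multiFactorial_pos ν)).ne'
      simpa [this] using h2.symm
    exact Lp.eq_zero_iff_ae_eq_zero.2 (ae_eq_zero_of_hermiteCoeff_eq_zero hF' h0))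

lemma hermiteBasis_apply (ν : Fin p → ℕ) : hermiteBasis p ν = hermiteVec ν := by
  simp [hermiteBasis]

section Pair

variable {Ω : Type*} [MeasurableSpace Ω] {P : Measure Ω} [IsProbabilityMeasure P]
  {X Y : Ω → Fin p → ℝ} {ρ : ℝ}

/-- Mehler's formula: the covariance of square integrable functions of a correlated pair. -/
theorem IsCorrelatedPair.hasSum_integral_mul (h : IsCorrelatedPair X Y ρ P)
    {F G : (Fin p → ℝ) → ℝ} (hF : MemLp F 2 (stdGauss p)) (hG : MemLp G 2 (stdGauss p)) :
    HasSum (fun ν : Fin p → ℕ =>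
        hermiteCoeff F ν * hermiteCoeff G ν / (multiFactorial ν : ℝ) * ρ ^ (∑ j, ν j))
      (∫ ω, F (X ω) * G (Y ω) ∂P) := by
  -- Composition with `X` and with `Y` are isometries into `L²(P)`. The form `⟨U ·, V ·⟩` is
  -- diagonal in the Hermite basis with entries `ρ^|ν|`, so by continuity the expansions can be
  -- inserted in one argument after the other.
  let U := Lp.compMeasurePreservingₗᵢ ℝ (E := ℝ) (p := 2) X h.measurePreserving_left
  let V := Lp.compMeasurePreservingₗᵢ ℝ (E := ℝ) (p := 2) Y h.measurePreserving_right
  have hUV : ∀ {F G : (Fin p → ℝ) → ℝ} (hF : MemLp F 2 (stdGauss p))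
      (hG : MemLp G 2 (stdGauss p)),
      inner ℝ (U hF.toLp) (V hG.toLp) = ∫ ω, F (X ω) * G (Y ω) ∂P := by
    intro F G hF hG
    have e1 : U hF.toLp = (hF.comp_measurePreserving h.measurePreserving_left).toLp :=
      Lp.toLp_compMeasurePreserving hF h.measurePreserving_left
    have e2 : V hG.toLp = (hG.comp_measurePreserving h.measurePreserving_right).toLp :=
      Lp.toLp_compMeasurePreserving hG h.measurePreserving_right
    rw [e1, e2, inner_toLp_toLp]
    rfl
  have hb : ∀ ν μ : Fin p → ℕ, inner ℝ (U (hermiteVec ν)) (V (hermiteVec μ))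
      = if ν = μ then ρ ^ (∑ j, ν j) else 0 := by
    intro ν μ
    rw [hermiteVec, hermiteVec, map_smul, map_smul, real_inner_smul_left, real_inner_smul_right,
      hUV, h.integral_hermiteProd_mul]
    split_ifs with hνμ
    · subst hνμ
      have := multiFactorial_pos ν
      rw [← mul_assoc, ← mul_inv, Real.mul_self_sqrt this.le, ← mul_assoc,
        inv_mul_cancel₀ this.ne', one_mul]
    · simp
  have hexp : ∀ {F : (Fin p → ℝ) → ℝ} (hF : MemLp F 2 (stdGauss p)),
      HasSum (fun ν => ((√(multiFactorial ν : ℝ))⁻¹ * hermiteCoeff F ν) • hermiteVec ν)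
        hF.toLp := by
    intro F hF
    have := (hermiteBasis p).hasSum_repr hF.toLp
    simpa only [HilbertBasis.repr_apply_apply, hermiteBasis_apply, inner_hermiteVec_toLp]
      using this
  have h1 : ∀ μ : Fin p → ℕ, inner ℝ (U hF.toLp) (V (hermiteVec μ))
      = (√(multiFactorial μ : ℝ))⁻¹ * hermiteCoeff F μ * ρ ^ (∑ j, μ j) := by
    intro μ
    have hs := ((hexp hF).mapL U.toContinuousLinearMap).mapL (innerSL ℝ (V (hermiteVec μ)))
    simp only [LinearIsometry.coe_toContinuousLinearMap, innerSL_apply_apply, map_smul,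
      smul_eq_mul] at hs
    have hs' := hasSum_single (f := fun ν => (√(multiFactorial ν : ℝ))⁻¹ * hermiteCoeff F ν *
      inner ℝ (V (hermiteVec μ)) (U (hermiteVec ν))) μ (by
        intro ν hν
        rw [real_inner_comm, hb, if_neg hν, mul_zero])
    rw [real_inner_comm, hs.unique hs', real_inner_comm, hb, if_pos rfl]
  have hs := ((hexp hG).mapL V.toContinuousLinearMap).mapL (innerSL ℝ (U hF.toLp))
  simp only [LinearIsometry.coe_toContinuousLinearMap, innerSL_apply_apply, map_smul,
    smul_eq_mul, h1, hUV] at hs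
  convert! hs using 2 with ν
  have := multiFactorial_pos ν
  nth_rw 1 [← Real.mul_self_sqrt this.le]
  have h2 := (Real.sqrt_pos.2 this).ne'
  field_simp

end Pair

lemma mem_multiIdx {k : ℕ} {ν : Fin p → ℕ} : ν ∈ multiIdx p k ↔ ∑ j, ν j = k := by
  simp [multiIdx]

/-- The sets `multiIdx p l` are the finite fibres of `ν ↦ |ν|`; this regroups Mehler's series as a
power series in `ρ`. -/
lemma hasSum_multiIdx {f : (Fin p → ℕ) → ℝ} {a : ℝ} (h : HasSum f a) :
    HasSum (fun l => ∑ ν ∈ multiIdx p l, f ν) a := by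
  have h1 := (Equiv.sigmaFiberEquiv fun ν : Fin p → ℕ => ∑ j, ν j).hasSum_iff.2 h
  refine h1.sigma fun l => ?_
  have e : ∑ ν ∈ multiIdx p l, f ν = ∑ ν : {x // x ∈ multiIdx p l}, f ν := by
    rw [Finset.sum_coe_sort]
  rw [e]
  have h2 := hasSum_fintype (fun ν : {x // x ∈ multiIdx p l} => f ν)
  refine ((Equiv.subtypeEquivRight fun ν => mem_multiIdx.symm :
    {ν : Fin p → ℕ // ∑ j, ν j = l} ≃ {x // x ∈ multiIdx p l}).hasSum_iff.2 h2)

lemma hermiteEnergy_nonneg (G : (Fin p → ℝ) → ℝ) (k : ℕ) : 0 ≤ hermiteEnergy G k :=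
  Finset.sum_nonneg fun ν _ => div_nonneg (sq_nonneg _) (multiFactorial_pos ν).le

section Pair

variable {Ω : Type*} [MeasurableSpace Ω] {P : Measure Ω} [IsProbabilityMeasure P]
  {X Y : Ω → Fin p → ℝ} {ρ : ℝ}

theorem IsCorrelatedPair.hasSum_integral_mul_level (h : IsCorrelatedPair X Y ρ P)
    {F G : (Fin p → ℝ) → ℝ} (hF : MemLp F 2 (stdGauss p)) (hG : MemLp G 2 (stdGauss p)) :
    HasSum (fun l => (∑ ν ∈ multiIdx p l,
        hermiteCoeff F ν * hermiteCoeff G ν / (multiFactorial ν : ℝ)) * ρ ^ l)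
      (∫ ω, F (X ω) * G (Y ω) ∂P) := by
  convert! hasSum_multiIdx (h.hasSum_integral_mul hF hG) using 2 with l
  rw [Finset.sum_mul]
  refine Finset.sum_congr rfl fun ν hν => ?_
  rw [mem_multiIdx.1 hν]

theorem IsCorrelatedPair.hasSum_integral_mul_self (h : IsCorrelatedPair X Y ρ P)
    {F : (Fin p → ℝ) → ℝ} (hF : MemLp F 2 (stdGauss p)) :
    HasSum (fun l => hermiteEnergy F l * ρ ^ l) (∫ ω, F (X ω) * F (Y ω) ∂P) := by
  simpa only [hermiteEnergy, sq] using h.hasSum_integral_mul_level hF hF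

end Pair

lemma summable_hermiteEnergy {F : (Fin p → ℝ) → ℝ} (hF : MemLp F 2 (stdGauss p)) :
    Summable (hermiteEnergy F) := by
  have h := (hermiteBasis p).hasSum_inner_mul_inner hF.toLp hF.toLp
  simp only [hermiteBasis_apply, real_inner_comm (hermiteVec _), inner_hermiteVec_toLp] at h
  refine (hasSum_multiIdx h).summable.congr fun l => ?_
  refine Finset.sum_congr rfl fun ν _ => ?_
  have := multiFactorial_pos ν
  nth_rw 3 [← Real.mul_self_sqrt this.le]
  have h2 := (Real.sqrt_pos.2 this).ne'
  field_simp

/-! ### The component of given order -/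

/-- The component of order `κ` of the Hermite expansion of `G`. -/
noncomputable def rankPart (G : (Fin p → ℝ) → ℝ) (κ : ℕ) (w : Fin p → ℝ) : ℝ :=
  ∑ ν ∈ multiIdx p κ, hermiteCoeff G ν / (multiFactorial ν : ℝ) * hermiteProd ν w

lemma memLp_rankPart (G : (Fin p → ℝ) → ℝ) (κ : ℕ) : MemLp (rankPart G κ) 2 (stdGauss p) :=
  memLp_finsetSum _ fun ν _ => (memLp_hermiteProd ν).const_mul _

lemma hermiteCoeff_rankPart (G : (Fin p → ℝ) → ℝ) (κ : ℕ) (μ : Fin p → ℕ) :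
    hermiteCoeff (rankPart G κ) μ = if μ ∈ multiIdx p κ then hermiteCoeff G μ else 0 := by
  have e : ∀ w, rankPart G κ w * hermiteProd μ w = ∑ ν ∈ multiIdx p κ,
      hermiteCoeff G ν / (multiFactorial ν : ℝ) * (hermiteProd ν w * hermiteProd μ w) := by
    intro w; rw [rankPart, Finset.sum_mul]; simp_rw [mul_assoc]
  rw [hermiteCoeff]
  simp_rw [e]
  have hint : ∀ ν ∈ multiIdx p κ, Integrable (fun w => hermiteCoeff G ν / (multiFactorial ν : ℝ) *
      (hermiteProd ν w * hermiteProd μ w)) (stdGauss p) := fun ν _ =>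
    ((memLp_hermiteProd ν).integrable_mul (memLp_hermiteProd μ)).const_mul _
  rw [integral_finsetSum _ hint]
  simp_rw [integral_const_mul, integral_hermiteProd_mul_stdGauss, mul_ite, mul_zero]
  rw [Finset.sum_ite_eq' (multiIdx p κ) μ]
  split_ifs
  · exact div_mul_cancel₀ _ (multiFactorial_pos μ).ne'
  · rfl

lemma hermiteCoeff_sub {F G : (Fin p → ℝ) → ℝ} (hF : MemLp F 2 (stdGauss p))
    (hG : MemLp G 2 (stdGauss p)) (ν : Fin p → ℕ) :
    hermiteCoeff (fun w => F w - G w) ν = hermiteCoeff F ν - hermiteCoeff G ν := by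
  simp_rw [hermiteCoeff, sub_mul]
  exact integral_sub (hF.integrable_mul (memLp_hermiteProd ν))
    (hG.integrable_mul (memLp_hermiteProd ν))

section Pair

variable {Ω : Type*} [MeasurableSpace Ω] {P : Measure Ω} [IsProbabilityMeasure P]
  {X Y : Ω → Fin p → ℝ} {ρ : ℝ} {G : (Fin p → ℝ) → ℝ}

theorem IsCorrelatedPair.integral_rankPart_mul_rankPart (h : IsCorrelatedPair X Y ρ P)
    (G : (Fin p → ℝ) → ℝ) (κ : ℕ) :
    ∫ ω, rankPart G κ (X ω) * rankPart G κ (Y ω) ∂P = hermiteEnergy G κ * ρ ^ κ := by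
  refine (h.hasSum_integral_mul_self (memLp_rankPart G κ)).unique ?_
  have e : hermiteEnergy G κ = hermiteEnergy (rankPart G κ) κ :=
    Finset.sum_congr rfl fun ν hν => by rw [hermiteCoeff_rankPart, if_pos hν]
  rw [e]
  refine hasSum_single κ fun l hl => ?_
  rw [hermiteEnergy, Finset.sum_eq_zero, zero_mul]
  intro ν hν
  rw [hermiteCoeff_rankPart, if_neg, sq, zero_mul, zero_div]
  rwa [mem_multiIdx, mem_multiIdx.1 hν]

lemma hermiteCoeff_sub_rankPart (hG : MemLp G 2 (stdGauss p)) (κ : ℕ) (ν : Fin p → ℕ) :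
    hermiteCoeff (fun w => G w - rankPart G κ w) ν
      = if ν ∈ multiIdx p κ then 0 else hermiteCoeff G ν := by
  rw [hermiteCoeff_sub hG (memLp_rankPart G κ), hermiteCoeff_rankPart]
  split_ifs <;> simp

/-- The Hermite coefficients of the two functions have disjoint supports, so every term of Mehler's
series vanishes. -/
theorem IsCorrelatedPair.integral_rankPart_mul_sub (h : IsCorrelatedPair X Y ρ P)
    (hG : MemLp G 2 (stdGauss p)) (κ : ℕ) :
    ∫ ω, rankPart G κ (X ω) * (G (Y ω) - rankPart G κ (Y ω)) ∂P = 0 := by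
  refine (h.hasSum_integral_mul (memLp_rankPart G κ) (hG.sub (memLp_rankPart G κ))).unique ?_
  convert! hasSum_zero using 2 with ν
  change hermiteCoeff (rankPart G κ) ν * hermiteCoeff (fun w => G w - rankPart G κ w) ν / _ * _ = 0
  rw [hermiteCoeff_sub_rankPart hG, hermiteCoeff_rankPart]
  split_ifs <;> simp

/-- Orders below `κ` vanish by the rank hypothesis, order `κ` by the subtraction. -/
lemma hermiteEnergy_sub_rankPart {κ : ℕ} (hG : HasHermiteRank G κ) (l : ℕ) :
    hermiteEnergy (fun w => G w - rankPart G κ w) l = if l ≤ κ then 0 else hermiteEnergy G l := by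
  split_ifs with hl
  · refine Finset.sum_eq_zero fun ν hν => ?_
    rw [hermiteCoeff_sub_rankPart hG.memLp]
    split_ifs with h
    · simp
    · rcases hl.lt_or_eq with h' | h'
      · rw [hG.coeff_eq_zero l h' ν hν]; simp
      · exact absurd (h' ▸ hν) h
  · refine Finset.sum_congr rfl fun ν hν => ?_
    rw [hermiteCoeff_sub_rankPart hG.memLp, if_neg]
    rw [mem_multiIdx, mem_multiIdx.1 hν]; omega

/-- Only orders `l ≥ κ + 1` remain in Mehler's series, and `|ρ|^l ≤ |ρ|^(κ+1)` for them because `|ρ|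
≤ 1`. -/
theorem IsCorrelatedPair.abs_integral_sub_mul_sub_le (h : IsCorrelatedPair X Y ρ P) {κ : ℕ}
    (hp : 0 < p) (hG : HasHermiteRank G κ) :
    |∫ ω, (G (X ω) - rankPart G κ (X ω)) * (G (Y ω) - rankPart G κ (Y ω)) ∂P|
      ≤ (∑' l, hermiteEnergy G (κ + 1 + l)) * |ρ| ^ (κ + 1) := by
  set R : (Fin p → ℝ) → ℝ := fun w => G w - rankPart G κ w with hR
  have hRL : MemLp R 2 (stdGauss p) := hG.memLp.sub (memLp_rankPart G κ)
  have hs := h.hasSum_integral_mul_self hRL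
  have hz : ∀ l < κ + 1, hermiteEnergy R l * ρ ^ l = 0 := by
    intro l hl
    rw [hR, hermiteEnergy_sub_rankPart hG, if_pos (by omega), zero_mul]
  have hs2 : HasSum (fun l => hermiteEnergy R (l + (κ + 1)) * ρ ^ (l + (κ + 1)))
      (∫ ω, R (X ω) * R (Y ω) ∂P) := by
    have := (hasSum_nat_add_iff' (κ + 1)).2 hs
    rwa [Finset.sum_eq_zero fun l hl => hz l (Finset.mem_range.1 hl), sub_zero] at this
  have hρ := h.abs_corr_le_one hp
  have hsum : Summable fun l => hermiteEnergy G (κ + 1 + l) :=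
    (summable_hermiteEnergy hG.memLp).comp_injective (add_right_injective (κ + 1))
  rw [← Real.norm_eq_abs]
  refine hs2.norm_le_of_bounded (hsum.hasSum.mul_right _) fun l => ?_
  rw [hR, hermiteEnergy_sub_rankPart hG, if_neg (by omega), add_comm l, norm_mul, norm_pow,
    Real.norm_eq_abs, Real.norm_eq_abs, abs_of_nonneg (hermiteEnergy_nonneg _ _)]
  refine mul_le_mul_of_nonneg_left ?_ (hermiteEnergy_nonneg _ _)
  exact pow_le_pow_of_le_one (abs_nonneg _) hρ (by omega)

lemma hermiteEnergy_rank_pos {κ : ℕ} (hG : HasHermiteRank G κ) : 0 < hermiteEnergy G κ := by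
  obtain ⟨ν, hν, hne⟩ := hG.exists_coeff_ne_zero
  exact Finset.sum_pos' (fun ν _ => div_nonneg (sq_nonneg _) (multiFactorial_pos ν).le)
    ⟨ν, hν, div_pos (by positivity) (multiFactorial_pos ν)⟩

/-- In dimension 0 the only multi-index has order 0, while `κ ≥ 1`. -/
lemma HasHermiteRank.pos_dim {κ : ℕ} (hG : HasHermiteRank G κ) : 0 < p := by
  obtain ⟨ν, hν, -⟩ := hG.exists_coeff_ne_zero
  rcases Nat.eq_zero_or_pos p with rfl | h
  · have := mem_multiIdx.1 hν
    have := hG.one_le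
    simp_all; omega
  · exact h

end Pair

end GaussianReduction

namespace GaussianReduction

/-! ### Slowly varying functions -/

/-- A continuous function with asymptotically vanishing increments grows sublinearly. -/
lemma eventually_abs_le_of_tendsto_increments {h : ℝ → ℝ} (hc : Continuous h)
    (hinc : ∀ v, Tendsto (fun u => h (u + v) - h u) atTop (𝓝 0)) {δ : ℝ} (hδ : 0 < δ) :
    ∀ᶠ u in atTop, |h u| ≤ δ * u := by
  -- These closed sets cover the line, so by Baire one of them contains a ball. This turns pointwise
  -- convergence of the increments into a bound uniform over an interval of `v`.
  let S : ℕ → Set ℝ := fun n => {v | ∀ u ≥ (n : ℝ), |h (u + v) - h u| ≤ 1}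
  have hSc : ∀ n, IsClosed (S n) := by
    intro n
    have : S n = ⋂ u ≥ (n : ℝ), {v | |h (u + v) - h u| ≤ 1} := by ext v; simp [S]
    rw [this]
    exact isClosed_biInter fun u _ => isClosed_le (by fun_prop) continuous_const
  have hSu : ⋃ n, S n = Set.univ := by
    rw [Set.eq_univ_iff_forall]
    intro v
    have h1 : ∀ᶠ u in atTop, |h (u + v) - h u| < 1 := by
      have := (hinc v).abs
      rw [abs_zero] at this
      exact this.eventually_lt_const one_pos
    obtain ⟨U, hU⟩ := eventually_atTop.1 h1
    obtain ⟨n, hn⟩ := exists_nat_ge U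
    exact Set.mem_iUnion.2 ⟨n, fun u hu => (hU u (hn.trans hu)).le⟩
  obtain ⟨n, v₀, hv₀⟩ := nonempty_interior_of_iUnion_of_closed hSc hSu
  rw [mem_interior_iff_mem_nhds, Metric.mem_nhds_iff] at hv₀
  obtain ⟨ε, hε, hball⟩ := hv₀
  set l : ℝ := ε / 2 with hl
  have hl0 : 0 < l := by positivity
  -- An increment by `s` is the difference of the increments by `v₀ + s` and by `v₀` from the base
  -- point `w - v₀`, each at most 1 in absolute value.
  have hosc : ∀ w ≥ (n : ℝ) + v₀, ∀ s, 0 ≤ s → s ≤ l → |h (w + s) - h w| ≤ 2 := by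
    intro w hw s hs0 hs
    have hm1 : v₀ + s ∈ S n := hball (by
      rw [Metric.mem_ball, Real.dist_eq, add_sub_cancel_left, abs_of_nonneg hs0]; linarith)
    have hm0 : v₀ ∈ S n := hball (Metric.mem_ball_self hε)
    have e1 := hm1 (w - v₀) (by linarith)
    have e0 := hm0 (w - v₀) (by linarith)
    rw [show w - v₀ + (v₀ + s) = w + s by ring] at e1
    rw [sub_add_cancel] at e0
    rw [abs_le] at *
    constructor <;> linarith
  -- Steps of length `l` telescope to growth of slope `δ / 2`; the other half of `δ` absorbs `|h
  -- W|`, the oscillation 2 and the offset `W`.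
  have hstep : ∀ᶠ w in atTop, |h (w + l) - h w| < δ / 2 * l := by
    have := (hinc l).abs
    rw [abs_zero] at this
    exact this.eventually_lt_const (by positivity)
  obtain ⟨W, hW⟩ := eventually_atTop.1 (hstep.and (eventually_ge_atTop ((n : ℝ) + v₀)))
  have hiter : ∀ k : ℕ, |h (W + k * l) - h W| ≤ k * (δ / 2 * l) := by
    intro k
    induction k with
    | zero => simp
    | succ k ih =>
      have h1 := (hW (W + k * l) (by have : 0 ≤ (k : ℝ) * l := by positivity
                                     linarith)).1
      push_cast
      rw [show W + ((k : ℝ) + 1) * l = W + k * l + l by ring]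
      rw [abs_le] at *
      rw [abs_lt] at h1
      constructor <;> linarith
  filter_upwards [eventually_ge_atTop W,
    eventually_ge_atTop (2 / δ * (|h W| + 2 + δ / 2 * |W|))] with w hw hw2
  set k := ⌊(w - W) / l⌋₊ with hk
  have hk1 : (k : ℝ) * l ≤ w - W := by
    rw [← le_div_iff₀ hl0]
    exact Nat.floor_le (div_nonneg (by linarith) hl0.le)
  have hk2 : w - W ≤ k * l + l := by
    have := (Nat.lt_floor_add_one ((w - W) / l)).le
    rw [div_le_iff₀ hl0] at this
    linarith
  have h1 := hosc (W + k * l) (by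
    have : 0 ≤ (k : ℝ) * l := by positivity
    linarith [(hW W le_rfl).2]) (w - W - k * l) (by linarith) (by linarith)
  rw [show W + k * l + (w - W - k * l) = w by ring] at h1
  have h2 := hiter k
  have h3 : (k : ℝ) * (δ / 2 * l) ≤ δ / 2 * (w - W) := by nlinarith
  have h4 : |h W| + 2 + δ / 2 * |W| ≤ δ / 2 * w := by
    have := mul_le_mul_of_nonneg_left hw2 (by positivity : 0 ≤ δ / 2)
    calc _ = δ / 2 * (2 / δ * (|h W| + 2 + δ / 2 * |W|)) := by field_simp
      _ ≤ _ := this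
  have h5 := neg_abs_le W
  have h6 : -(δ / 2 * W) ≤ δ / 2 * |W| := by nlinarith
  have h7 := abs_le.1 (le_refl |h W|)
  rw [abs_le] at *
  constructor <;> linarith [h7.1, h7.2, h1.1, h1.2, h2.1, h2.2]

/-- A continuous slowly varying function is eventually between `t ^ (-δ)` and `t ^ δ`. -/
lemma IsSlowlyVarying.eventually_rpow_bounds {L : ℝ → ℝ} (hL : IsSlowlyVarying L)
    (hc : ContinuousOn L (Set.Ioi 0)) {δ : ℝ} (hδ : 0 < δ) :
    ∀ᶠ t in atTop, 0 < L t ∧ t ^ (-δ) ≤ L t ∧ L t ≤ t ^ δ := by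
  obtain ⟨⟨t₀, ht₀, -⟩, hlim⟩ := hL
  set a : ℝ := Real.log (max t₀ 1) with ha
  have hpos : ∀ u ≥ a, 0 < L (Real.exp u) := by
    intro u hu
    apply ht₀
    calc t₀ ≤ max t₀ 1 := le_max_left _ _
      _ = Real.exp a := (Real.exp_log (by positivity)).symm
      _ ≤ Real.exp u := Real.exp_le_exp.2 hu
  -- Logarithmic coordinates turn slow variation into vanishing increments; freezing `h` below `a`,
  -- where `L` might not be positive, keeps it continuous on the whole line.
  set h : ℝ → ℝ := fun u => Real.log (L (Real.exp (max u a))) with hh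
  have hcont : Continuous h := by
    refine Continuous.log ?_ fun u => (hpos _ (le_max_right _ _)).ne'
    exact hc.comp_continuous (by fun_prop) fun u => Real.exp_pos _
  have hinc : ∀ v, Tendsto (fun u => h (u + v) - h u) atTop (𝓝 0) := by
    intro v
    have h1 := ((hlim (Real.exp v) (Real.exp_pos v)).comp Real.tendsto_exp_atTop).log one_ne_zero
    rw [Real.log_one] at h1
    refine h1.congr' ?_
    filter_upwards [eventually_ge_atTop a, eventually_ge_atTop (a - v)] with u hu hu2
    have hu3 : a ≤ u + v := by linarith
    simp only [hh, Function.comp, max_eq_left hu, max_eq_left hu3]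
    rw [← Real.exp_add, add_comm v u, Real.log_div (hpos _ hu3).ne' (hpos _ hu).ne']
  have hev := Real.tendsto_log_atTop.eventually
    ((eventually_abs_le_of_tendsto_increments hcont hinc hδ).and (eventually_ge_atTop a))
  filter_upwards [hev, eventually_gt_atTop 0] with t ⟨ht, hta⟩ ht0
  have hLt : 0 < L t := by simpa [Real.exp_log ht0] using hpos _ hta
  simp only [hh, max_eq_left hta, Real.exp_log ht0] at ht
  rw [abs_le] at ht
  refine ⟨hLt, ?_, ?_⟩
  · rw [← Real.log_le_log_iff (by positivity) hLt, Real.log_rpow ht0]; linarith [ht.1]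
  · rw [← Real.log_le_log_iff hLt (by positivity), Real.log_rpow ht0]; linarith [ht.2]

/-! ### The covariance function of a strongly dependent field -/

/-- The correlation function `‖x‖ ^ (-α) L(‖x‖)`, with the value `1` at the origin. -/
noncomputable def corr (α : ℝ) (L : ℝ → ℝ) (t : ℝ) : ℝ := if t = 0 then 1 else t ^ (-α) * L t

namespace IsStronglyDependentField

variable {d p : ℕ} {Ω : Type*} [MeasurableSpace Ω] {P : Measure Ω}
  {η : EuclideanSpace ℝ (Fin d) → Ω → (Fin p → ℝ)} {α : ℝ} {L : ℝ → ℝ}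

lemma measurable_apply (hη : IsStronglyDependentField η P α L) (x : EuclideanSpace ℝ (Fin d)) :
    Measurable (η x) := hη.field.measurable.comp measurable_prodMk_left

lemma memLp_coord (hη : IsStronglyDependentField η P α L) (x : EuclideanSpace ℝ (Fin d))
    (i : Fin p) : MemLp (fun ω => η x ω i) 2 P :=
  ((hη.field.gaussian.hasGaussianLaw_eval x).map
    (ContinuousLinearMap.proj (R := ℝ) (φ := fun _ : Fin p => ℝ) i)).memLp_two

variable [IsProbabilityMeasure P]

/-- Isotropy moves the pair `(x, y)` to `(0, y - x)`, where the covariance is prescribed. -/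
lemma cov_eq_corr (hη : IsStronglyDependentField η P α L) (x y : EuclideanSpace ℝ (Fin d))
    (i j : Fin p) : cov[fun ω => η x ω i, fun ω => η y ω j; P]
      = (1 : Matrix (Fin p) (Fin p) ℝ) i j * corr α L ‖x - y‖ := by
  rw [hη.field.cov_isotropic x y 0 (y - x) i j (by rw [zero_sub, norm_neg, norm_sub_rev]),
    covariance_eq_sub (hη.memLp_coord _ _) (hη.memLp_coord _ _), hη.mean_zero, zero_mul, sub_zero]
  simp only [Pi.mul_apply, corr]
  by_cases h : x = y
  · subst h; simp [hη.cov_zero]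
  · have h1 : y - x ≠ 0 := sub_ne_zero.2 (Ne.symm h)
    have h2 : ‖x - y‖ ≠ 0 := norm_ne_zero_iff.2 (sub_ne_zero.2 h)
    rw [hη.cov_eq _ h1, if_neg h2, norm_sub_rev]

lemma isCorrelatedPair (hη : IsStronglyDependentField η P α L) (x y : EuclideanSpace ℝ (Fin d)) :
    IsCorrelatedPair (η x) (η y) (corr α L ‖x - y‖) P where
  measurable_left := hη.measurable_apply x
  measurable_right := hη.measurable_apply y
  gaussian := hη.field.gaussian.hasGaussianLaw_prodMk
  mean_left := hη.mean_zero x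
  mean_right := hη.mean_zero y
  cov_left i j := by simp [hη.cov_eq_corr, corr]
  cov_right i j := by simp [hη.cov_eq_corr, corr]
  cov_cross := hη.cov_eq_corr x y

lemma measurePreserving (hη : IsStronglyDependentField η P α L) (x : EuclideanSpace ℝ (Fin d)) :
    MeasurePreserving (η x) P (stdGauss p) := (hη.isCorrelatedPair x x).measurePreserving_left

lemma integral_coord_mul (hη : IsStronglyDependentField η P α L)
    (x y : EuclideanSpace ℝ (Fin d)) (i : Fin p) :
    ∫ ω, η x ω i * η y ω i ∂P = corr α L ‖x - y‖ := by
  have := hη.cov_eq_corr x y i i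
  rw [covariance_eq_sub (hη.memLp_coord _ _) (hη.memLp_coord _ _), hη.mean_zero, zero_mul,
    sub_zero] at this
  simpa using this

/-- By Cauchy–Schwarz against the unit vector `η_i(0)`, a squared increment of the correlation is at
most the mean-square increment of the field. -/
lemma continuous_corr_norm (hη : IsStronglyDependentField η P α L) (hp : 0 < p) :
    Continuous fun x : EuclideanSpace ℝ (Fin d) => corr α L ‖x‖ := by
  let i : Fin p := ⟨0, hp⟩
  have hb : ∀ x, corr α L ‖x‖ = ∫ ω, η 0 ω i * η x ω i ∂P := by
    intro x; rw [hη.integral_coord_mul, zero_sub, norm_neg]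
  have hint : ∀ x y, Integrable (fun ω => η x ω i * η y ω i) P := fun x y =>
    (hη.memLp_coord x i).integrable_mul (hη.memLp_coord y i)
  have hbd : ∀ x y, (corr α L ‖y‖ - corr α L ‖x‖) ^ 2
      ≤ ∫ ω, ∑ j, (η y ω j - η x ω j) ^ 2 ∂P := by
    intro x y
    have hD : ∀ j, MemLp (fun ω => η y ω j - η x ω j) 2 P := fun j =>
      (hη.memLp_coord y j).sub (hη.memLp_coord x j)
    have e1 : corr α L ‖y‖ - corr α L ‖x‖ = inner ℝ (hη.memLp_coord 0 i).toLp (hD i).toLp := by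
      rw [inner_toLp_toLp, hb, hb, ← integral_sub (hint _ _) (hint _ _)]
      simp_rw [mul_sub]
    have h0 : inner ℝ (hη.memLp_coord 0 i).toLp (hη.memLp_coord 0 i).toLp = (1 : ℝ) := by
      rw [inner_toLp_toLp, hη.integral_coord_mul]; simp [corr]
    have cs := real_inner_mul_inner_self_le (hη.memLp_coord 0 i).toLp (hD i).toLp
    rw [← e1, h0, one_mul, ← sq, inner_toLp_toLp] at cs
    refine cs.trans (integral_mono ((hD i).integrable_mul (hD i))
      (integrable_finsetSum _ fun j _ => (hD j).integrable_sq) fun ω => ?_)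
    simp only
    rw [← sq]
    exact Finset.single_le_sum (f := fun j => (η y ω j - η x ω j) ^ 2)
      (fun j _ => sq_nonneg _) (Finset.mem_univ i)
  rw [continuous_iff_continuousAt]
  intro x
  have h1 : Tendsto (fun y => (corr α L ‖y‖ - corr α L ‖x‖) ^ 2) (𝓝 x) (𝓝 0) :=
    squeeze_zero (fun _ => sq_nonneg _) (hbd x) (hη.field.meanSquareContinuous x)
  have h2 := h1.sqrt
  simp only [Real.sqrt_sq_eq_abs, Real.sqrt_zero] at h2
  rw [ContinuousAt, tendsto_iff_dist_tendsto_zero]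
  simpa only [Real.dist_eq] using h2

lemma abs_corr_norm_le_one (hη : IsStronglyDependentField η P α L) (hp : 0 < p)
    (x : EuclideanSpace ℝ (Fin d)) : |corr α L ‖x‖| ≤ 1 := by
  simpa using (hη.isCorrelatedPair x 0).abs_corr_le_one hp

lemma norm_smul_single_eq (hd : 0 < d) {t : ℝ} (ht : 0 ≤ t) :
    ‖(t • EuclideanSpace.single ⟨0, hd⟩ 1 : EuclideanSpace ℝ (Fin d))‖ = t := by
  rw [norm_smul]; simp [abs_of_nonneg ht]

/-- Along a ray from the origin `L(t) = t^α B(t)`, so `L` inherits continuity from the correlation.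
-/
lemma continuousOn_slowlyVarying (hη : IsStronglyDependentField η P α L) (hd : 0 < d)
    (hp : 0 < p) : ContinuousOn L (Set.Ioi 0) := by
  have h1 : Continuous fun t : ℝ =>
      corr α L ‖(t • EuclideanSpace.single ⟨0, hd⟩ 1 : EuclideanSpace ℝ (Fin d))‖ :=
    (hη.continuous_corr_norm hp).comp (by fun_prop)
  have h2 : ContinuousOn (fun t : ℝ => t ^ α) (Set.Ioi 0) := fun t ht =>
    (Real.continuousAt_rpow_const t α (Or.inl (ne_of_gt ht))).continuousWithinAt
  refine (h2.mul h1.continuousOn).congr fun t ht => ?_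
  have ht : 0 < t := ht
  simp only [norm_smul_single_eq hd ht.le, corr, if_neg ht.ne', Pi.mul_apply]
  rw [← mul_assoc, ← Real.rpow_add ht]; simp

/-- Potter-type bounds for the correlation function. -/
lemma eventually_corr_bounds (hη : IsStronglyDependentField η P α L) (hd : 0 < d) (hp : 0 < p)
    {δ : ℝ} (hδ : 0 < δ) :
    ∀ᶠ t in atTop, t ^ (-(α + δ)) ≤ corr α L t ∧ corr α L t ≤ t ^ (-(α - δ)) := by
  filter_upwards [hη.slowlyVarying.eventually_rpow_bounds (hη.continuousOn_slowlyVarying hd hp) hδ,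
    eventually_gt_atTop 0] with t ⟨_, h2, h3⟩ ht
  have hα : 0 < t ^ (-α) := by positivity
  rw [corr, if_neg ht.ne', neg_add, neg_sub, Real.rpow_add ht, sub_eq_add_neg, add_comm δ,
    Real.rpow_add ht]
  exact ⟨mul_le_mul_of_nonneg_left h2 hα.le, mul_le_mul_of_nonneg_left h3 hα.le⟩

end IsStronglyDependentField

end GaussianReduction

namespace GaussianReduction

/-! ### Double integrals over dilated sets -/

section Dilation

variable {d : ℕ} {Δ : Set (EuclideanSpace ℝ (Fin d))}

lemma isFiniteMeasure_restrict_smul (hΔ : Bornology.IsBounded Δ) (r : ℝ) :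
    IsFiniteMeasure (volume.restrict (r • Δ)) :=
  isFiniteMeasure_restrict.2 (hΔ.smul₀ r).measure_lt_top.ne

lemma volume_real_smul {r : ℝ} (hr : 0 ≤ r) :
    (volume.restrict (r • Δ)).real Set.univ = r ^ d * volume.real Δ := by
  have : 0 ≤ r ^ d := by positivity
  simp [measureReal_def, Measure.addHaar_smul, abs_of_nonneg, hr, this]

lemma volume_real_pos (hΔ : Bornology.IsBounded Δ) (h0 : 0 ∈ interior Δ) : 0 < volume.real Δ :=
  ENNReal.toReal_pos (Measure.measure_pos_of_nonempty_interior _ ⟨0, h0⟩).ne'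
    hΔ.measure_lt_top.ne

/-- The closed ball is a measurable superset of `r • Δ`, so the bound holds almost everywhere for
the restricted measure without measurability of `r • Δ`. -/
lemma exists_ae_restrict_smul_norm_le (hΔ : Bornology.IsBounded Δ) :
    ∃ D > 0, ∀ r > 0, ∀ᵐ x ∂(volume.restrict (r • Δ)), ‖x‖ ≤ D * r := by
  obtain ⟨D, hD0, hD⟩ := hΔ.exists_pos_norm_le
  refine ⟨D, hD0, fun r hr => ?_⟩
  have hsub : r • Δ ⊆ Metric.closedBall 0 (D * r) := by
    rintro _ ⟨x, hx, rfl⟩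
    simp only [mem_closedBall_zero_iff, norm_smul, Real.norm_eq_abs, abs_of_pos hr]
    rw [mul_comm]
    exact mul_le_mul_of_nonneg_right (hD x hx) hr.le
  have h1 : ∀ᵐ x ∂(volume.restrict (Metric.closedBall (0 : EuclideanSpace ℝ (Fin d)) (D * r))),
      x ∈ Metric.closedBall (0 : EuclideanSpace ℝ (Fin d)) (D * r) :=
    ae_restrict_mem Metric.isClosed_closedBall.measurableSet
  filter_upwards [ae_mono (Measure.restrict_mono hsub le_rfl) h1] with x hx
  simpa using hx

lemma integrable_comp_sub_right {f : EuclideanSpace ℝ (Fin d) → ℝ} (hf : Continuous f)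
    {C : ℝ} (hb : ∀ z, |f z| ≤ C) (μ : Measure (EuclideanSpace ℝ (Fin d))) [IsFiniteMeasure μ]
    (x : EuclideanSpace ℝ (Fin d)) : Integrable (fun y => f (x - y)) μ :=
  (integrable_const C).mono' (Continuous.aestronglyMeasurable (by fun_prop))
    (ae_of_all _ fun _ => hb _)

lemma integrable_comp_sub_prod {f : EuclideanSpace ℝ (Fin d) → ℝ} (hf : Continuous f)
    {C : ℝ} (hb : ∀ z, |f z| ≤ C) (μ : Measure (EuclideanSpace ℝ (Fin d))) [IsFiniteMeasure μ] :
    Integrable (fun q : EuclideanSpace ℝ (Fin d) × EuclideanSpace ℝ (Fin d) => f (q.1 - q.2))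
      (μ.prod μ) :=
  (integrable_const C).mono' (Continuous.aestronglyMeasurable (by fun_prop))
    (ae_of_all _ fun _ => hb _)

/-- Lower bound for the double integral of a function with slowly decaying positive tail. -/
lemma exists_le_integral_integral (hΔ : Bornology.IsBounded Δ) (h0 : 0 ∈ interior Δ)
    {f : EuclideanSpace ℝ (Fin d) → ℝ} (hf : Continuous f) (hb : ∀ z, |f z| ≤ 1)
    {s T : ℝ} (hs : 0 ≤ s) (hsd : s < d)
    (h : ∀ z, (1 + ‖z‖) ^ (-s) - 2 * (Metric.closedBall 0 T).indicator (fun _ => (1 : ℝ)) z ≤ f z) :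
    ∃ c > 0, ∀ᶠ r : ℝ in atTop, c * r ^ (2 * d - s) ≤ ∫ x in r • Δ, ∫ y in r • Δ, f (x - y) := by
  obtain ⟨D, hD0, hD⟩ := exists_ae_restrict_smul_norm_le hΔ
  set V := volume.real Δ with hV
  have hV0 : 0 < V := volume_real_pos hΔ h0
  set b := volume.real (Metric.closedBall (0 : EuclideanSpace ℝ (Fin d)) T) with hbdef
  have hb0 : 0 ≤ b := measureReal_nonneg
  -- For `r ≥ 1` almost all pairs satisfy `1 + ‖x - y‖ ≤ (1 + 2D) r`. The first term is of order
  -- `r^(2d - s)`; the ball correction is only of order `r^d`, negligible since `s < d`.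
  have hmain : ∀ r : ℝ, 1 ≤ r →
      ((1 + 2 * D) * r) ^ (-s) * (r ^ d * V) ^ 2 - 2 * b * (r ^ d * V)
        ≤ ∫ x in r • Δ, ∫ y in r • Δ, f (x - y) := by
    intro r hr
    have hr0 : 0 < r := by linarith
    have := isFiniteMeasure_restrict_smul hΔ r
    have hvol := volume_real_smul (Δ := Δ) hr0.le
    set μ := volume.restrict (r • Δ) with hμ
    have hinner : ∀ᵐ x ∂μ, ((1 + 2 * D) * r) ^ (-s) * (r ^ d * V) - 2 * b
        ≤ ∫ y, f (x - y) ∂μ := by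
      filter_upwards [hD r hr0] with x hx
      have hind : ∫ y, (Metric.closedBall 0 T).indicator (fun _ => (1 : ℝ)) (x - y) ∂μ ≤ b := by
        have e : (fun y => (Metric.closedBall (0 : EuclideanSpace ℝ (Fin d)) T).indicator
            (fun _ => (1 : ℝ)) (x - y)) = (Metric.closedBall x T).indicator (fun _ => (1 : ℝ)) := by
          ext y
          simp [Set.indicator, dist_eq_norm, norm_sub_rev]
        rw [e, integral_indicator Metric.isClosed_closedBall.measurableSet, setIntegral_const,
          smul_eq_mul, mul_one, hbdef, measureReal_def, measureReal_def]
        refine ENNReal.toReal_mono Metric.isBounded_closedBall.measure_lt_top.ne ?_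
        rw [← Measure.addHaar_closedBall_center volume x T]
        exact Measure.restrict_apply_le _ _
      have hindi : Integrable (fun y => (Metric.closedBall (0 : EuclideanSpace ℝ (Fin d)) T).indicator
            (fun _ => (1 : ℝ)) (x - y)) μ := by
        refine (integrable_const (1 : ℝ)).mono' ?_ (ae_of_all _ fun y => ?_)
        · refine Measurable.aestronglyMeasurable ?_
          exact (measurable_const.indicator Metric.isClosed_closedBall.measurableSet).comp
            (by fun_prop)
        · simp only [Set.indicator]; split_ifs <;> simp
      calc ((1 + 2 * D) * r) ^ (-s) * (r ^ d * V) - 2 * b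
          ≤ (∫ _y, ((1 + 2 * D) * r) ^ (-s) ∂μ)
            - ∫ y, 2 * (Metric.closedBall 0 T).indicator (fun _ => (1 : ℝ)) (x - y) ∂μ := by
            rw [integral_const, hvol, integral_const_mul, smul_eq_mul, mul_comm (r ^ d * V)]
            linarith
        _ = ∫ y, (((1 + 2 * D) * r) ^ (-s)
            - 2 * (Metric.closedBall 0 T).indicator (fun _ => (1 : ℝ)) (x - y)) ∂μ :=
            (integral_sub (integrable_const _) (hindi.const_mul 2)).symm
        _ ≤ ∫ y, f (x - y) ∂μ := by
            refine integral_mono_ae ((integrable_const _).sub (hindi.const_mul 2))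
              (integrable_comp_sub_right hf hb μ x) ?_
            filter_upwards [hD r hr0] with y hy
            refine le_trans (sub_le_sub_right ?_ _) (h (x - y))
            refine Real.rpow_le_rpow_of_nonpos (by positivity) ?_ (by linarith)
            have := norm_sub_le x y
            nlinarith
    have hI := (integrable_comp_sub_prod hf hb μ).integral_prod_left
    calc _ = ∫ _x, (((1 + 2 * D) * r) ^ (-s) * (r ^ d * V) - 2 * b) ∂μ := by
            rw [integral_const, hvol, smul_eq_mul]; ring
      _ ≤ _ := integral_mono_ae (integrable_const _) hI hinner
  set c := (1 + 2 * D) ^ (-s) * V ^ 2 with hc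
  have hc0 : 0 < c := by positivity
  refine ⟨c / 2, by positivity, ?_⟩
  have hlim : Tendsto (fun r : ℝ => 2 * b * V * r ^ (-(d - s))) atTop (𝓝 (2 * b * V * 0)) :=
    (tendsto_rpow_neg_atTop (by linarith)).const_mul _
  rw [mul_zero] at hlim
  filter_upwards [eventually_ge_atTop 1, hlim.eventually_lt_const (by positivity : 0 < c / 2)]
    with r hr hsmall
  have hr0 : 0 < r := by linarith
  refine le_trans ?_ (hmain r hr)
  have e1 : r ^ (2 * d - s : ℝ) = r ^ (-s) * (r ^ d) ^ 2 := by
    rw [← pow_mul, ← Real.rpow_natCast r (d * 2), ← Real.rpow_add hr0]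
    congr 1; push_cast; ring
  have e2 : r ^ (-(d - s)) * r ^ (2 * d - s : ℝ) = r ^ d := by
    rw [← Real.rpow_natCast r d, ← Real.rpow_add hr0]
    congr 1; ring
  have hpos : 0 < r ^ (2 * d - s : ℝ) := by positivity
  have h3 := mul_le_mul_of_nonneg_right hsmall.le hpos.le
  rw [mul_assoc, e2] at h3
  have e3 : ((1 + 2 * D) * r) ^ (-s) * (r ^ d * V) ^ 2 = c * r ^ (2 * d - s : ℝ) := by
    rw [e1, Real.mul_rpow (by positivity) hr0.le, hc]; ring
  rw [e3]
  linarith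

/-- In polar coordinates the integrand becomes `t^(d - 1 - a)`, integrable at 0 because the exponent
exceeds `-1`. -/
lemma integrableOn_norm_rpow_neg (hd : 0 < d) {a : ℝ} (had : a < d) (R : ℝ) :
    IntegrableOn (fun z : EuclideanSpace ℝ (Fin d) => ‖z‖ ^ (-a)) (Metric.ball 0 R) := by
  have : Nonempty (Fin d) := ⟨⟨0, hd⟩⟩
  rw [integrableOn_fun_norm_addHaar volume (f := fun t => t ^ (-a))]
  rcases le_or_gt R 0 with hR | hR
  · simp [Set.Ioo_eq_empty (not_lt.2 hR)]
  have h1 : IntegrableOn (fun y : ℝ => y ^ ((d : ℝ) - 1 - a)) (Set.Ioo 0 R) := by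
    have := (intervalIntegral.intervalIntegrable_rpow' (a := 0) (b := R) (r := (d : ℝ) - 1 - a)
      (by linarith))
    rw [intervalIntegrable_iff_integrableOn_Ioo_of_le hR.le] at this
    exact this
  refine h1.congr_fun (fun y hy => ?_) measurableSet_Ioo
  simp only [smul_eq_mul, finrank_euclideanSpace, Fintype.card_fin]
  rw [← Real.rpow_natCast, ← Real.rpow_add hy.1]
  congr 1
  rw [Nat.cast_sub hd]; push_cast; ring

lemma setIntegral_ball_norm_rpow_neg {a R : ℝ} (hR : 0 < R) :
    ∫ z in Metric.ball (0 : EuclideanSpace ℝ (Fin d)) R, ‖z‖ ^ (-a)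
      = R ^ (d - a) * ∫ z in Metric.ball (0 : EuclideanSpace ℝ (Fin d)) 1, ‖z‖ ^ (-a) := by
  have h := Measure.setIntegral_comp_smul_of_pos (volume : Measure (EuclideanSpace ℝ (Fin d)))
    (fun z : EuclideanSpace ℝ (Fin d) => ‖z‖ ^ (-a)) (Metric.ball 0 1) hR
  rw [smul_unitBall_of_pos hR] at h
  have e : ∀ z : EuclideanSpace ℝ (Fin d), ‖R • z‖ ^ (-a) = R ^ (-a) * ‖z‖ ^ (-a) := by
    intro z
    rw [norm_smul, Real.norm_eq_abs, abs_of_pos hR, Real.mul_rpow hR.le (norm_nonneg _)]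
  simp_rw [e] at h
  rw [integral_const_mul, finrank_euclideanSpace, Fintype.card_fin, smul_eq_mul] at h
  rw [sub_eq_add_neg, Real.rpow_add hR, Real.rpow_natCast, mul_assoc, h, ← mul_assoc,
    mul_inv_cancel₀ (by positivity), one_mul]

/-- Upper bound for the double integral of a function with decaying tail. -/
lemma exists_integral_integral_le (hΔ : Bornology.IsBounded Δ) (hd : 0 < d)
    {f : EuclideanSpace ℝ (Fin d) → ℝ} (hf : Continuous f) (hb : ∀ z, |f z| ≤ 1)
    {a C : ℝ} (had : a < d) (hC : 0 ≤ C)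
    (h : ∀ z ≠ 0, f z ≤ C * ‖z‖ ^ (-a)) :
    ∃ C' : ℝ, ∀ r > 0, ∫ x in r • Δ, ∫ y in r • Δ, f (x - y) ≤ C' * r ^ (2 * d - a) := by
  obtain ⟨D, hD0, hD⟩ := exists_ae_restrict_smul_norm_le hΔ
  set K := ∫ z in Metric.ball (0 : EuclideanSpace ℝ (Fin d)) 1, ‖z‖ ^ (-a) with hK
  refine ⟨volume.real Δ * (C * ((3 * D) ^ (d - a) * K)), fun r hr => ?_⟩
  have := isFiniteMeasure_restrict_smul hΔ r
  have hvol := volume_real_smul (Δ := Δ) hr.le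
  set μ := volume.restrict (r • Δ) with hμ
  -- Differences of points of `r • Δ` have norm at most `2Dr` almost everywhere; the factor 3 puts
  -- them inside the open ball.
  set R := 3 * D * r with hR
  have hR0 : 0 < R := by positivity
  have : Nonempty (Fin d) := ⟨⟨0, hd⟩⟩
  set g : EuclideanSpace ℝ (Fin d) → ℝ :=
    fun z => C * (Metric.ball 0 R).indicator (fun z => ‖z‖ ^ (-a)) z with hg
  have hgi : Integrable g := ((integrableOn_norm_rpow_neg hd had R).integrable_indicator
    Metric.isOpen_ball.measurableSet).const_mul C
  have hgnn : ∀ z, 0 ≤ g z := fun z =>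
    mul_nonneg hC (Set.indicator_nonneg (fun z _ => by positivity) z)
  have hgint : ∫ z, g z = C * (R ^ (d - a) * K) := by
    rw [hg, integral_const_mul, integral_indicator Metric.isOpen_ball.measurableSet,
      setIntegral_ball_norm_rpow_neg hR0]
  have hinner : ∀ᵐ x ∂μ, ∫ y, f (x - y) ∂μ ≤ C * (R ^ (d - a) * K) := by
    filter_upwards [hD r hr] with x hx
    have hgx : Integrable (fun y => g (x - y)) := hgi.comp_sub_left x
    calc ∫ y, f (x - y) ∂μ ≤ ∫ y, g (x - y) ∂μ := by
          refine integral_mono_ae (integrable_comp_sub_right hf hb μ x) hgx.restrict ?_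
          have hne : ∀ᵐ y ∂μ, y ≠ x :=
            ae_mono Measure.restrict_le_self (Measure.ae_ne volume x)
          filter_upwards [hD r hr, hne] with y hy hyx
          have hmem : x - y ∈ Metric.ball (0 : EuclideanSpace ℝ (Fin d)) R := by
            rw [mem_ball_zero_iff]
            have := norm_sub_le x y
            nlinarith [mul_pos hD0 hr]
          simp only [hg, Set.indicator_of_mem hmem]
          exact h _ (sub_ne_zero.2 (Ne.symm hyx))
      _ ≤ ∫ y, g (x - y) := integral_mono_measure Measure.restrict_le_self
          (ae_of_all _ fun _ => hgnn _) hgx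
      _ = _ := by rw [integral_sub_left_eq_self g volume x, hgint]
  calc ∫ x, ∫ y, f (x - y) ∂μ ∂μ ≤ ∫ _x, C * (R ^ (d - a) * K) ∂μ :=
        integral_mono_ae (integrable_comp_sub_prod hf hb μ).integral_prod_left
          (integrable_const _) hinner
    _ = _ := by
        rw [integral_const, hvol, smul_eq_mul, hR, Real.mul_rpow (by positivity) hr.le]
        have : r ^ (2 * d - a : ℝ) = r ^ d * r ^ (d - a : ℝ) := by
          rw [← Real.rpow_natCast r d, ← Real.rpow_add hr]; congr 1; ring
        rw [this]; ring

end Dilation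

/-! ### Comparison of the integrals of powers of the correlation -/

namespace IsStronglyDependentField

variable {d p κ : ℕ} {Ω : Type*} [MeasurableSpace Ω] {P : Measure Ω} [IsProbabilityMeasure P]
  {η : EuclideanSpace ℝ (Fin d) → Ω → (Fin p → ℝ)} {α γ : ℝ} {L : ℝ → ℝ}
  {Δ : Set (EuclideanSpace ℝ (Fin d))}

/-- The double integral of the `κ`-th power of the correlation function is eventually positive and
dominates that of higher powers by a power of `r`. -/
theorem tendsto_corr_integral_ratio (hη : IsStronglyDependentField η P α L) (hd : 0 < d)
    (hp : 0 < p) (hΔ : Bornology.IsBounded Δ) (h0 : 0 ∈ interior Δ) (hγ : 0 < γ)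
    (hγα : γ < α) (hγd : γ < d - α * κ) :
    (∀ᶠ r : ℝ in atTop, 0 < ∫ x in r • Δ, ∫ y in r • Δ, corr α L ‖x - y‖ ^ κ) ∧
    Tendsto (fun r : ℝ => r ^ (γ / 2) * ((∫ x in r • Δ, ∫ y in r • Δ, |corr α L ‖x - y‖| ^ (κ + 1)) /
      ∫ x in r • Δ, ∫ y in r • Δ, corr α L ‖x - y‖ ^ κ)) atTop (𝓝 0) := by
  -- The exponents leave room on all sides. From `δ(κ + 1) = γ/8` follows `s ≤ ακ + γ/8`; `γ < d -
  -- ακ` gives `s, a < d`; `γ < α` gives `(α - δ)(κ + 1) ≥ ακ + 7γ/8 ≥ a`. Finally `γ/2 + s - a ≤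
  -- -γ/8`.
  set δ : ℝ := γ / (8 * (κ + 1)) with hδ
  have hδ0 : 0 < δ := by positivity
  have hδκ : δ * (κ + 1) = γ / 8 := by rw [hδ]; field_simp
  set s : ℝ := (α + δ) * κ with hs
  set a : ℝ := α * κ + 3 * γ / 4 with ha
  have hκ0 : (0 : ℝ) ≤ κ := Nat.cast_nonneg κ
  have hα := hη.alpha_pos
  have ha0 : 0 < a := by positivity
  have had : a < d := by rw [ha]; linarith
  have hs0 : 0 ≤ s := by positivity
  have hs1 : s ≤ α * κ + γ / 8 := by rw [hs]; nlinarith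
  obtain ⟨T, hT⟩ := eventually_atTop.1
    ((hη.eventually_corr_bounds hd hp hδ0).and (eventually_ge_atTop 1))
  have hT1 : 1 ≤ T := (hT T le_rfl).2
  have hc := hη.continuous_corr_norm hp
  have hb := hη.abs_corr_norm_le_one hp
  obtain ⟨c, hc0, hlow⟩ := exists_le_integral_integral (f := fun z => corr α L ‖z‖ ^ κ)
    (s := s) (T := T) hΔ h0 (hc.pow κ)
    (fun z => by rw [abs_pow]; exact pow_le_one₀ (abs_nonneg _) (hb z)) hs0 (by linarith) (by
      intro z
      rcases le_or_gt ‖z‖ T with hz | hz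
      -- Near the origin the correlation may be negative, but its power is at least `-1` and the
      -- first term at most 1; this accounts for the 2 in front of the indicator.
      · rw [Set.indicator_of_mem (by simpa using hz)]
        have h1 : (1 + ‖z‖) ^ (-s) ≤ 1 :=
          Real.rpow_le_one_of_one_le_of_nonpos (by linarith [norm_nonneg z]) (by linarith)
        have h2 : |corr α L ‖z‖ ^ κ| ≤ 1 := by
          rw [abs_pow]; exact pow_le_one₀ (abs_nonneg _) (hb z)
        linarith [(abs_le.1 h2).1]
      · rw [Set.indicator_of_notMem (by simpa using hz), mul_zero, sub_zero]
        have hz0 : 0 < ‖z‖ := by linarith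
        have h1 := (hT ‖z‖ hz.le).1.1
        calc (1 + ‖z‖) ^ (-s) ≤ ‖z‖ ^ (-s) :=
              Real.rpow_le_rpow_of_nonpos hz0 (by linarith) (by linarith)
          _ = (‖z‖ ^ (-(α + δ))) ^ κ := by
              rw [← Real.rpow_natCast, ← Real.rpow_mul hz0.le, hs, neg_mul]
          _ ≤ _ := pow_le_pow_left₀ (by positivity) h1 κ)
  obtain ⟨C, hup⟩ := exists_integral_integral_le (f := fun z => |corr α L ‖z‖| ^ (κ + 1))
    (a := a) (C := T ^ a) hΔ hd (hc.abs.pow _)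
    (fun z => by rw [abs_pow, abs_abs]; exact pow_le_one₀ (abs_nonneg _) (hb z))
    had (by positivity) (by
      intro z hz
      have hz0 : 0 < ‖z‖ := norm_pos_iff.2 hz
      rcases le_or_gt ‖z‖ T with hz | hz
      · calc |corr α L ‖z‖| ^ (κ + 1) ≤ 1 := pow_le_one₀ (abs_nonneg _) (hb z)
          _ = ‖z‖ ^ a * ‖z‖ ^ (-a) := by rw [← Real.rpow_add hz0]; simp
          _ ≤ T ^ a * ‖z‖ ^ (-a) := by gcongr
      · have h1 := (hT ‖z‖ hz.le).1
        have h2 : 0 ≤ corr α L ‖z‖ := le_trans (by positivity) h1.1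
        rw [abs_of_nonneg h2]
        calc corr α L ‖z‖ ^ (κ + 1) ≤ (‖z‖ ^ (-(α - δ))) ^ (κ + 1) := pow_le_pow_left₀ h2 h1.2 _
          _ = ‖z‖ ^ (-((α - δ) * (κ + 1))) := by
              rw [← Real.rpow_natCast, ← Real.rpow_mul hz0.le]; push_cast; rw [neg_mul]
          _ ≤ ‖z‖ ^ (-a) := by
              refine Real.rpow_le_rpow_of_exponent_le (by linarith) ?_
              rw [ha]; linarith
          _ ≤ T ^ a * ‖z‖ ^ (-a) := le_mul_of_one_le_left (by positivity)
              (Real.one_le_rpow hT1 ha0.le))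
  have hpos : ∀ᶠ r : ℝ in atTop, 0 < ∫ x in r • Δ, ∫ y in r • Δ, corr α L ‖x - y‖ ^ κ := by
    filter_upwards [hlow, eventually_gt_atTop 0] with r hr hr0
    exact lt_of_lt_of_le (by positivity) hr
  refine ⟨hpos, ?_⟩
  have hlim : Tendsto (fun r : ℝ => C / c * r ^ (-(γ / 8))) atTop (𝓝 (C / c * 0)) :=
    (tendsto_rpow_neg_atTop (by positivity)).const_mul _
  rw [mul_zero] at hlim
  have hJ0 : ∀ r : ℝ, 0 ≤ ∫ x in r • Δ, ∫ y in r • Δ, |corr α L ‖x - y‖| ^ (κ + 1) := fun r =>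
    integral_nonneg fun x => integral_nonneg fun y => by positivity
  refine squeeze_zero' ?_ ?_ hlim
  · filter_upwards [hpos, eventually_gt_atTop 0] with r hr hr0
    exact mul_nonneg (by positivity) (div_nonneg (hJ0 r) hr.le)
  · filter_upwards [hlow, hpos, eventually_ge_atTop 1] with r hr hrp hr1
    have hr0 : 0 < r := by linarith
    have hJ := hup r hr0
    -- The upper bound does not supply the sign of `C`; it follows from nonnegativity of the
    -- integral it dominates.
    have hC0 : 0 ≤ C := by
      by_contra hneg
      have : C * r ^ (2 * d - a) < 0 := mul_neg_of_neg_of_pos (by linarith) (by positivity)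
      linarith [hJ0 r]
    calc r ^ (γ / 2) * ((∫ x in r • Δ, ∫ y in r • Δ, |corr α L ‖x - y‖| ^ (κ + 1)) /
          ∫ x in r • Δ, ∫ y in r • Δ, corr α L ‖x - y‖ ^ κ)
        ≤ r ^ (γ / 2) * ((C * r ^ (2 * d - a)) / (c * r ^ (2 * d - s))) := by
          gcongr
      _ = C / c * r ^ (γ / 2 + (s - a)) := by
          have e : r ^ (s - a) = r ^ (2 * d - a) / r ^ (2 * d - s) := by
            rw [← Real.rpow_sub hr0]; congr 1; ring
          rw [Real.rpow_add hr0, e]; ring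
      _ ≤ C / c * r ^ (-(γ / 8)) := by
          refine mul_le_mul_of_nonneg_left ?_ (by positivity)
          refine Real.rpow_le_rpow_of_exponent_le hr1 ?_
          rw [ha]; linarith

end IsStronglyDependentField

end GaussianReduction

namespace GaussianReduction

/-! ### Second moments of integral functionals -/

section Fubini

variable {E Ω : Type*} [MeasurableSpace E] [MeasurableSpace Ω] {μ : Measure E} {P : Measure Ω}
  [IsFiniteMeasure μ] [IsProbabilityMeasure P]

/-- Cauchy–Schwarz against the constant 1. -/
lemma sq_integral_le_measureReal_mul {f : E → ℝ} (hf : MemLp f 2 μ) :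
    (∫ x, f x ∂μ) ^ 2 ≤ μ.real Set.univ * ∫ x, f x ^ 2 ∂μ := by
  have h1 : MemLp (fun _ : E => (1 : ℝ)) 2 μ := memLp_const 1
  have cs := real_inner_mul_inner_self_le h1.toLp hf.toLp
  simp_rw [inner_toLp_toLp] at cs
  simpa [← sq] using cs

lemma MemLp.integral_left {h : E × Ω → ℝ} (hh : MemLp h 2 (μ.prod P)) :
    MemLp (fun ω => ∫ x, h (x, ω) ∂μ) 2 P := by
  have hm : AEStronglyMeasurable (fun ω => ∫ x, h (x, ω) ∂μ) P :=
    hh.aestronglyMeasurable.prod_swap.integral_prod_right'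
  have hsq := hh.integrable_sq
  rw [memLp_two_iff_integrable_sq hm]
  refine (hsq.integral_prod_right.const_mul (μ.real Set.univ)).mono' (hm.pow 2) ?_
  filter_upwards [hsq.prod_left_ae, hh.aestronglyMeasurable.prod_swap.prodMk_left]
    with ω hω hmω
  rw [Real.norm_eq_abs, abs_of_nonneg (sq_nonneg _)]
  exact sq_integral_le_measureReal_mul ((memLp_two_iff_integrable_sq hmω).2 hω)

lemma integral_mul_integral {h : E × Ω → ℝ} (hh : MemLp h 2 (μ.prod P)) {G : Ω → ℝ}
    (hG : MemLp G 2 P) :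
    ∫ ω, G ω * ∫ y, h (y, ω) ∂μ ∂P = ∫ y, ∫ ω, G ω * h (y, ω) ∂P ∂μ := by
  simp_rw [← integral_const_mul]
  refine integral_integral_swap (f := fun ω y => G ω * h (y, ω)) ?_
  have := ((hG.comp_snd μ).integrable_mul hh).swap
  exact this

end Fubini

/-! ### Square integrable functionals of the field -/

section Field

variable {d p : ℕ} {Ω : Type*} [MeasurableSpace Ω] {P : Measure Ω} [IsProbabilityMeasure P]
  {η : EuclideanSpace ℝ (Fin d) → Ω → (Fin p → ℝ)} {α : ℝ} {L : ℝ → ℝ}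
  {μ : Measure (EuclideanSpace ℝ (Fin d))} [IsFiniteMeasure μ]
  {F G : (Fin p → ℝ) → ℝ}

namespace IsStronglyDependentField

/-- Every `η x` has the standard Gaussian law. Consequently a function that is only a.e. strongly
measurable for that law can be composed with the field on the product space, where Fubini applies.
-/
lemma map_prod_eq (hη : IsStronglyDependentField η P α L)
    (μ : Measure (EuclideanSpace ℝ (Fin d))) [IsFiniteMeasure μ] :
    (μ.prod P).map (fun q => η q.1 q.2) = μ Set.univ • stdGauss p := by
  ext s hs
  rw [Measure.map_apply hη.field.measurable hs,
    Measure.prod_apply (hη.field.measurable hs)]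
  have : ∀ x, P (Prod.mk x ⁻¹' ((fun q : EuclideanSpace ℝ (Fin d) × Ω => η q.1 q.2) ⁻¹' s))
      = stdGauss p s := fun x => (hη.measurePreserving x).measure_preimage hs.nullMeasurableSet
  simp_rw [this]
  simp [mul_comm]

lemma memLp_comp (hη : IsStronglyDependentField η P α L)
    (μ : Measure (EuclideanSpace ℝ (Fin d))) [IsFiniteMeasure μ]
    (hF : MemLp F 2 (stdGauss p)) :
    MemLp (fun q : EuclideanSpace ℝ (Fin d) × Ω => F (η q.1 q.2)) 2 (μ.prod P) := by
  refine MemLp.comp_of_map (f := fun q : EuclideanSpace ℝ (Fin d) × Ω => η q.1 q.2) ?_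
    hη.field.measurable.aemeasurable
  rw [hη.map_prod_eq]
  exact hF.smul_measure (measure_ne_top _ _)

lemma memLp_integral (hη : IsStronglyDependentField η P α L)
    (μ : Measure (EuclideanSpace ℝ (Fin d))) [IsFiniteMeasure μ]
    (hF : MemLp F 2 (stdGauss p)) : MemLp (fun ω => ∫ x, F (η x ω) ∂μ) 2 P :=
  MemLp.integral_left (h := fun q : EuclideanSpace ℝ (Fin d) × Ω => F (η q.1 q.2))
    (hη.memLp_comp μ hF)

lemma ae_integrable (hη : IsStronglyDependentField η P α L)
    (μ : Measure (EuclideanSpace ℝ (Fin d))) [IsFiniteMeasure μ]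
    (hF : MemLp F 2 (stdGauss p)) : ∀ᵐ ω ∂P, Integrable (fun x => F (η x ω)) μ :=
  ((hη.memLp_comp μ hF).integrable (by norm_num)).prod_left_ae

lemma integral_integral_eq (hη : IsStronglyDependentField η P α L)
    (μ : Measure (EuclideanSpace ℝ (Fin d))) [IsFiniteMeasure μ]
    (hF : MemLp F 2 (stdGauss p)) :
    ∫ ω, ∫ x, F (η x ω) ∂μ ∂P = μ.real Set.univ * ∫ w, F w ∂(stdGauss p) := by
  have h := integral_mul_integral (hη.memLp_comp μ hF) (memLp_const (1 : ℝ))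
  simp only [one_mul] at h
  rw [h]
  have : ∀ x, ∫ ω, F (η x ω) ∂P = ∫ w, F w ∂(stdGauss p) := by
    intro x
    have hx := hη.measurePreserving x
    rw [← hx.map_eq, integral_map hx.measurable.aemeasurable]
    rw [hx.map_eq]; exact hF.aestronglyMeasurable
  simp [this]

lemma integral_mul_integral_eq (hη : IsStronglyDependentField η P α L)
    (μ : Measure (EuclideanSpace ℝ (Fin d))) [IsFiniteMeasure μ]
    (hF : MemLp F 2 (stdGauss p)) (hG : MemLp G 2 (stdGauss p)) :
    ∫ ω, (∫ x, F (η x ω) ∂μ) * ∫ y, G (η y ω) ∂μ ∂P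
      = ∫ x, ∫ y, ∫ ω, F (η x ω) * G (η y ω) ∂P ∂μ ∂μ := by
  have h1 := integral_mul_integral (hη.memLp_comp μ hF) (hη.memLp_integral μ hG)
  simp_rw [mul_comm (∫ x, F (η x _) ∂μ)]
  rw [h1]
  congr 1; ext x
  have h2 := integral_mul_integral (hη.memLp_comp μ hG)
    (hF.comp_measurePreserving (hη.measurePreserving x))
  simp_rw [mul_comm (∫ y, G (η y _) ∂μ)]
  exact h2

end IsStronglyDependentField

end Field

lemma hermiteCoeff_zero {p : ℕ} (F : (Fin p → ℝ) → ℝ) :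
    hermiteCoeff F 0 = ∫ w, F w ∂(stdGauss p) := by
  simp [hermiteCoeff, hermiteProd]

lemma zero_mem_multiIdx_zero {p : ℕ} : (0 : Fin p → ℕ) ∈ multiIdx p 0 := by
  simp [mem_multiIdx]

/-! ### Means, variances and covariance of the two functionals -/

section Functionals

variable {d p κ : ℕ} {Ω : Type*} [MeasurableSpace Ω] {P : Measure Ω} [IsProbabilityMeasure P]
  {η : EuclideanSpace ℝ (Fin d) → Ω → (Fin p → ℝ)} {α : ℝ} {L : ℝ → ℝ}
  {Δ : Set (EuclideanSpace ℝ (Fin d))} {G : ℝ → (Fin p → ℝ) → ℝ} {r : ℝ}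

namespace IsStronglyDependentField

/-- Sum and integral can be exchanged for those `ω` along whose path all the Hermite products are
integrable, which is almost every `ω`. -/
lemma rankFunctional_ae_eq (hη : IsStronglyDependentField η P α L)
    (hΔ : Bornology.IsBounded Δ) (G : ℝ → (Fin p → ℝ) → ℝ) (κ : ℕ) (r : ℝ) :
    rankFunctional Δ G κ η r =ᵐ[P] fun ω => ∫ x in r • Δ, rankPart (G r) κ (η x ω) := by
  have := isFiniteMeasure_restrict_smul hΔ r
  have h : ∀ᵐ ω ∂P, ∀ ν ∈ multiIdx p κ,
      Integrable (fun x => hermiteProd ν (η x ω)) (volume.restrict (r • Δ)) :=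
    (Filter.eventually_all_finset _).2 fun ν _ => hη.ae_integrable _ (memLp_hermiteProd ν)
  filter_upwards [h] with ω hω
  simp only [rankFunctional, rankPart]
  rw [integral_finsetSum _ fun ν hν => (hω ν hν).const_mul _]
  simp_rw [integral_const_mul]

lemma memLp_fullFunctional (hη : IsStronglyDependentField η P α L)
    (hΔ : Bornology.IsBounded Δ) (hG : HasHermiteRank (G r) κ) :
    MemLp (fullFunctional Δ G η r) 2 P := by
  have := isFiniteMeasure_restrict_smul hΔ r
  exact hη.memLp_integral _ hG.memLp

lemma memLp_rankFunctional (hη : IsStronglyDependentField η P α L)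
    (hΔ : Bornology.IsBounded Δ) (G : ℝ → (Fin p → ℝ) → ℝ) (κ : ℕ) (r : ℝ) :
    MemLp (rankFunctional Δ G κ η r) 2 P := by
  have := isFiniteMeasure_restrict_smul hΔ r
  exact (memLp_congr_ae (hη.rankFunctional_ae_eq hΔ G κ r)).2
    (hη.memLp_integral _ (memLp_rankPart (G r) κ))

lemma integral_fullFunctional (hη : IsStronglyDependentField η P α L)
    (hΔ : Bornology.IsBounded Δ) (hG : HasHermiteRank (G r) κ) :
    ∫ ω, fullFunctional Δ G η r ω ∂P = 0 := by
  have := isFiniteMeasure_restrict_smul hΔ r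
  simp only [fullFunctional]
  rw [hη.integral_integral_eq _ hG.memLp, ← hermiteCoeff_zero,
    hG.coeff_eq_zero 0 hG.one_le 0 zero_mem_multiIdx_zero, mul_zero]

lemma integral_rankFunctional (hη : IsStronglyDependentField η P α L)
    (hΔ : Bornology.IsBounded Δ) (hG : HasHermiteRank (G r) κ) :
    ∫ ω, rankFunctional Δ G κ η r ω ∂P = 0 := by
  have := isFiniteMeasure_restrict_smul hΔ r
  rw [integral_congr_ae (hη.rankFunctional_ae_eq hΔ G κ r),
    hη.integral_integral_eq _ (memLp_rankPart (G r) κ), ← hermiteCoeff_zero,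
    hermiteCoeff_rankPart]
  rw [hG.coeff_eq_zero 0 hG.one_le 0 zero_mem_multiIdx_zero]
  simp

lemma variance_rankFunctional (hη : IsStronglyDependentField η P α L)
    (hΔ : Bornology.IsBounded Δ) (hG : HasHermiteRank (G r) κ) :
    Var[rankFunctional Δ G κ η r; P]
      = hermiteEnergy (G r) κ * ∫ x in r • Δ, ∫ y in r • Δ, corr α L ‖x - y‖ ^ κ := by
  have := isFiniteMeasure_restrict_smul hΔ r
  have hm := (hη.memLp_rankFunctional hΔ G κ r).aemeasurable
  rw [variance_of_integral_eq_zero hm (hη.integral_rankFunctional hΔ hG)]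
  have e : ∫ ω, rankFunctional Δ G κ η r ω ^ 2 ∂P
      = ∫ ω, (∫ x in r • Δ, rankPart (G r) κ (η x ω)) * (∫ y in r • Δ, rankPart (G r) κ (η y ω)) ∂P := by
    refine integral_congr_ae ?_
    filter_upwards [hη.rankFunctional_ae_eq hΔ G κ r] with ω hω
    rw [hω, sq]
  rw [e, hη.integral_mul_integral_eq _ (memLp_rankPart (G r) κ) (memLp_rankPart (G r) κ)]
  simp_rw [(hη.isCorrelatedPair _ _).integral_rankPart_mul_rankPart, integral_const_mul]

/-- The remainder of the full functional after removing its component of rank order. -/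
lemma remainder_ae_eq (hη : IsStronglyDependentField η P α L)
    (hΔ : Bornology.IsBounded Δ) (hG : HasHermiteRank (G r) κ) :
    (fun ω => fullFunctional Δ G η r ω - rankFunctional Δ G κ η r ω) =ᵐ[P]
      fun ω => ∫ x in r • Δ, (G r (η x ω) - rankPart (G r) κ (η x ω)) := by
  have := isFiniteMeasure_restrict_smul hΔ r
  filter_upwards [hη.rankFunctional_ae_eq hΔ G κ r, hη.ae_integrable (volume.restrict (r • Δ))
    hG.memLp, hη.ae_integrable (volume.restrict (r • Δ)) (memLp_rankPart (G r) κ)] with ω h1 h2 h3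
  rw [h1, integral_sub h2 h3, fullFunctional]

lemma integral_rank_mul_remainder (hη : IsStronglyDependentField η P α L)
    (hΔ : Bornology.IsBounded Δ) (hG : HasHermiteRank (G r) κ) :
    ∫ ω, rankFunctional Δ G κ η r ω *
      (fullFunctional Δ G η r ω - rankFunctional Δ G κ η r ω) ∂P = 0 := by
  have := isFiniteMeasure_restrict_smul hΔ r
  have e : ∫ ω, rankFunctional Δ G κ η r ω *
      (fullFunctional Δ G η r ω - rankFunctional Δ G κ η r ω) ∂P
      = ∫ ω, (∫ x in r • Δ, rankPart (G r) κ (η x ω)) *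
          (∫ y in r • Δ, (G r (η y ω) - rankPart (G r) κ (η y ω))) ∂P := by
    refine integral_congr_ae ?_
    filter_upwards [hη.rankFunctional_ae_eq hΔ G κ r, hη.remainder_ae_eq hΔ hG] with ω h1 h2
    rw [h2, h1]
  rw [e, hη.integral_mul_integral_eq (G := fun w => G r w - rankPart (G r) κ w) _
    (memLp_rankPart (G r) κ) (hG.memLp.sub (memLp_rankPart (G r) κ))]
  simp_rw [(hη.isCorrelatedPair _ _).integral_rankPart_mul_sub hG.memLp]
  simp

/-- The rank functional is uncorrelated with the remainder, that is, it is an orthogonal projection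
of the full functional. -/
lemma covariance_full_rank (hη : IsStronglyDependentField η P α L)
    (hΔ : Bornology.IsBounded Δ) (hG : HasHermiteRank (G r) κ) :
    cov[fullFunctional Δ G η r, rankFunctional Δ G κ η r; P]
      = Var[rankFunctional Δ G κ η r; P] := by
  have hK := hη.memLp_fullFunctional hΔ hG
  have hR := hη.memLp_rankFunctional hΔ G κ r
  have h := hη.integral_rank_mul_remainder hΔ hG
  have h0 : cov[rankFunctional Δ G κ η r,
      fullFunctional Δ G η r - rankFunctional Δ G κ η r; P] = 0 := by
    rw [covariance_eq_sub hR (hK.sub hR), hη.integral_rankFunctional hΔ hG, zero_mul, sub_zero]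
    exact h
  rw [covariance_sub_right hR hK hR, covariance_self hR.aemeasurable, sub_eq_zero] at h0
  rw [covariance_comm, h0]

lemma variance_full_eq (hη : IsStronglyDependentField η P α L)
    (hΔ : Bornology.IsBounded Δ) (hG : HasHermiteRank (G r) κ) :
    Var[fullFunctional Δ G η r; P] = Var[rankFunctional Δ G κ η r; P]
      + Var[fullFunctional Δ G η r - rankFunctional Δ G κ η r; P] := by
  rw [variance_sub (hη.memLp_fullFunctional hΔ hG) (hη.memLp_rankFunctional hΔ G κ r),
    hη.covariance_full_rank hΔ hG]
  ring

lemma variance_remainder_le (hη : IsStronglyDependentField η P α L)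
    (hΔ : Bornology.IsBounded Δ) (hG : HasHermiteRank (G r) κ) :
    Var[fullFunctional Δ G η r - rankFunctional Δ G κ η r; P]
      ≤ (∑' l, hermiteEnergy (G r) (κ + 1 + l)) *
        ∫ x in r • Δ, ∫ y in r • Δ, |corr α L ‖x - y‖| ^ (κ + 1) := by
  have := isFiniteMeasure_restrict_smul hΔ r
  set μ := volume.restrict (r • Δ) with hμ
  have hp := hG.pos_dim
  have hK := hη.memLp_fullFunctional hΔ hG
  have hR := hη.memLp_rankFunctional hΔ G κ r
  have hmean : ∫ ω, (fullFunctional Δ G η r - rankFunctional Δ G κ η r) ω ∂P = 0 := by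
    simp only [Pi.sub_apply]
    rw [integral_sub (hK.integrable (by norm_num)) (hR.integrable (by norm_num)),
      hη.integral_fullFunctional hΔ hG, hη.integral_rankFunctional hΔ hG, sub_zero]
  rw [variance_of_integral_eq_zero (hK.sub hR).aemeasurable hmean]
  have hRL : MemLp (fun w => G r w - rankPart (G r) κ w) 2 (stdGauss p) :=
    hG.memLp.sub (memLp_rankPart (G r) κ)
  have e : ∫ ω, (fullFunctional Δ G η r - rankFunctional Δ G κ η r) ω ^ 2 ∂P
      = ∫ x, ∫ y, ∫ ω, (G r (η x ω) - rankPart (G r) κ (η x ω)) *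
          (G r (η y ω) - rankPart (G r) κ (η y ω)) ∂P ∂μ ∂μ := by
    rw [← hη.integral_mul_integral_eq μ hRL hRL]
    refine integral_congr_ae ?_
    filter_upwards [hη.remainder_ae_eq hΔ hG] with ω h2
    rw [Pi.sub_apply, h2, sq]
  have hc := hη.continuous_corr_norm hp
  have hcont : Continuous fun z : EuclideanSpace ℝ (Fin d) => |corr α L ‖z‖| ^ (κ + 1) :=
    hc.abs.pow _
  have hb : ∀ z : EuclideanSpace ℝ (Fin d), |(|corr α L ‖z‖| ^ (κ + 1))| ≤ 1 := fun z => by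
    rw [abs_pow, abs_abs]; exact pow_le_one₀ (abs_nonneg _) (hη.abs_corr_norm_le_one hp z)
  set A := ∑' l, hermiteEnergy (G r) (κ + 1 + l) with hA
  have hpt : ∀ x y, |∫ ω, (G r (η x ω) - rankPart (G r) κ (η x ω)) *
      (G r (η y ω) - rankPart (G r) κ (η y ω)) ∂P| ≤ A * |corr α L ‖x - y‖| ^ (κ + 1) :=
    fun x y => (hη.isCorrelatedPair x y).abs_integral_sub_mul_sub_le hp hG
  rw [e, ← integral_const_mul]
  refine (le_abs_self _).trans ?_
  rw [← Real.norm_eq_abs]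
  refine norm_integral_le_of_norm_le
    ((integrable_comp_sub_prod hcont hb μ).integral_prod_left.const_mul A)
    (ae_of_all _ fun x => ?_)
  rw [← integral_const_mul]
  exact norm_integral_le_of_norm_le ((integrable_comp_sub_right hcont hb μ x).const_mul A)
    (ae_of_all _ fun y => hpt x y)

end IsStronglyDependentField

end Functionals

end GaussianReduction

namespace GaussianReduction

/-! ### Limit laws -/

section LimitLaw

variable {Ω : Type*} [MeasurableSpace Ω] {P : Measure Ω}

lemma HasLimitLaw.congr {X Y : ℝ → Ω → ℝ} {μ : ProbabilityMeasure ℝ} (hX : HasLimitLaw P X μ)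
    (h : ∀ᶠ r in atTop, X r = Y r) : HasLimitLaw P Y μ := by
  refine ⟨?_, fun f => (hX.2 f).congr' ?_⟩
  · filter_upwards [hX.1, h] with r h1 h2
    rwa [← h2]
  · filter_upwards [h] with r h2
    rw [h2]

variable [IsProbabilityMeasure P]

lemma HasLimitLaw.tendstoInDistribution {X : ℝ → Ω → ℝ} {μ : ProbabilityMeasure ℝ}
    (hX : HasLimitLaw P X μ) (hm : ∀ r, AEMeasurable (X r) P) :
    TendstoInDistribution X atTop id (fun _ => P) (μ : Measure ℝ) := by
  refine ⟨hm, aemeasurable_id, ?_⟩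
  refine ProbabilityMeasure.tendsto_iff_forall_integral_tendsto.2 fun f => ?_
  simp only [ProbabilityMeasure.coe_mk, Measure.map_id]
  refine (hX.2 f).congr fun r => ?_
  rw [integral_map (hm r) f.continuous.aestronglyMeasurable]

lemma HasLimitLaw.of_tendstoInDistribution {X : ℝ → Ω → ℝ} {μ : ProbabilityMeasure ℝ}
    (h : TendstoInDistribution X atTop id (fun _ => P) (μ : Measure ℝ)) : HasLimitLaw P X μ := by
  refine ⟨Eventually.of_forall h.forall_aemeasurable, fun f => ?_⟩
  have h1 := (ProbabilityMeasure.tendsto_iff_forall_integral_tendsto.1 h.tendsto) f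
  simp only [ProbabilityMeasure.coe_mk, Measure.map_id] at h1
  refine h1.congr fun r => ?_
  rw [integral_map (h.forall_aemeasurable r) f.continuous.aestronglyMeasurable]

/-- Families that are asymptotically equal in `L²` have the same limit laws. -/
lemma HasLimitLaw.of_tendsto_integral_sq_sub {X Y : ℝ → Ω → ℝ} {μ : ProbabilityMeasure ℝ}
    (hX : HasLimitLaw P X μ) (hXm : ∀ᶠ r in atTop, MemLp (X r) 2 P)
    (hYm : ∀ᶠ r in atTop, MemLp (Y r) 2 P)
    (h : Tendsto (fun r => ∫ ω, (Y r ω - X r ω) ^ 2 ∂P) atTop (𝓝 0)) : HasLimitLaw P Y μ := by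
  classical
  -- `TendstoInDistribution` asks for measurability at every `r`, known here only eventually;
  -- replacing both variables by 0 at the other `r` does not affect the limit.
  let p : ℝ → Prop := fun r => MemLp (X r) 2 P ∧ MemLp (Y r) 2 P
  have hp : ∀ᶠ r in atTop, p r := hXm.and hYm
  let X' : ℝ → Ω → ℝ := fun r => if p r then X r else 0
  let Y' : ℝ → Ω → ℝ := fun r => if p r then Y r else 0
  have hX' : ∀ r, MemLp (X' r) 2 P := by
    intro r; simp only [X']; split_ifs with hr
    exacts [hr.1, MemLp.zero]
  have hY' : ∀ r, MemLp (Y' r) 2 P := by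
    intro r; simp only [Y']; split_ifs with hr
    exacts [hr.2, MemLp.zero]
  have hXX : ∀ᶠ r in atTop, X r = X' r := hp.mono fun r hr => by simp [X', hr]
  have hYY : ∀ᶠ r in atTop, Y' r = Y r := hp.mono fun r hr => by simp [Y', hr]
  have hXd := (hX.congr hXX).tendstoInDistribution fun r => (hX' r).aemeasurable
  refine HasLimitLaw.congr (HasLimitLaw.of_tendstoInDistribution ?_) hYY
  refine tendstoInDistribution_of_tendstoInMeasure_sub Y' id hXd ?_ fun r => (hY' r).aemeasurable
  refine tendstoInMeasure_of_tendsto_eLpNorm (p := 2) (by norm_num)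
    (fun r => ((hY' r).sub (hX' r)).aestronglyMeasurable) aestronglyMeasurable_zero ?_
  have e : ∀ r, eLpNorm ((Y' - X') r - 0) 2 P
      = ENNReal.ofReal (√(∫ ω, (Y' r ω - X' r ω) ^ 2 ∂P)) := by
    intro r
    have hm : MemLp (Y' r - X' r) 2 P := (hY' r).sub (hX' r)
    rw [sub_zero, Pi.sub_apply, hm.eLpNorm_eq_integral_rpow_norm (by norm_num) (by norm_num)]
    simp [Real.sqrt_eq_rpow]
  refine Tendsto.congr (fun r => (e r).symm) ?_
  rw [← ENNReal.ofReal_zero]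
  refine ENNReal.tendsto_ofReal ?_
  rw [← Real.sqrt_zero]
  refine Tendsto.sqrt (h.congr' ?_)
  filter_upwards [hXX, hYY] with r h1 h2
  rw [h1, h2]

lemma hasLimitLaw_iff_of_tendsto_integral_sq_sub {X Y : ℝ → Ω → ℝ} {μ : ProbabilityMeasure ℝ}
    (hXm : ∀ᶠ r in atTop, MemLp (X r) 2 P) (hYm : ∀ᶠ r in atTop, MemLp (Y r) 2 P)
    (h : Tendsto (fun r => ∫ ω, (X r ω - Y r ω) ^ 2 ∂P) atTop (𝓝 0)) :
    HasLimitLaw P X μ ↔ HasLimitLaw P Y μ := by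
  refine ⟨fun hX => hX.of_tendsto_integral_sq_sub hXm hYm (h.congr fun r => ?_),
    fun hY => hY.of_tendsto_integral_sq_sub hYm hXm h⟩
  refine integral_congr_ae (ae_of_all _ fun ω => ?_)
  simp only; ring

/-- Distance in `L²` between two standardized centred variables, one of which is the orthogonal
projection of the other. -/
lemma integral_sq_sub_standardized {K R : Ω → ℝ} (hK : MemLp K 2 P) (hR : MemLp R 2 P)
    (hK0 : ∫ ω, K ω ∂P = 0) (hR0 : ∫ ω, R ω ∂P = 0) (hcov : cov[K, R; P] = Var[R; P])
    (hKv : 0 < Var[K; P]) (hRv : 0 < Var[R; P]) :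
    ∫ ω, (K ω / √(Var[K; P]) - R ω / √(Var[R; P])) ^ 2 ∂P
      = 2 - 2 * (√(Var[K; P] / Var[R; P]))⁻¹ := by
  set a := √(Var[K; P]) with ha
  set b := √(Var[R; P]) with hb
  have ha0 : 0 < a := Real.sqrt_pos.2 hKv
  have hb0 : 0 < b := Real.sqrt_pos.2 hRv
  have ha2 : Var[K; P] = a ^ 2 := (Real.sq_sqrt hKv.le).symm
  have hb2 : Var[R; P] = b ^ 2 := (Real.sq_sqrt hRv.le).symm
  have hKi := (hK.integrable (by norm_num)).const_mul a⁻¹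
  have hRi := (hR.integrable (by norm_num)).const_mul b⁻¹
  have hK' : MemLp (fun ω => a⁻¹ * K ω) 2 P := hK.const_mul _
  have hR' : MemLp (fun ω => b⁻¹ * R ω) 2 P := hR.const_mul _
  have hmean : ∫ ω, (a⁻¹ * K ω - b⁻¹ * R ω) ∂P = 0 := by
    rw [integral_sub hKi hRi, integral_const_mul, integral_const_mul, hK0, hR0]; simp
  have hv := variance_of_integral_eq_zero (hK'.sub hR').aemeasurable hmean
  have e : ∫ ω, (K ω / a - R ω / b) ^ 2 ∂P = Var[fun ω => a⁻¹ * K ω - b⁻¹ * R ω; P] := by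
    rw [show (fun ω => a⁻¹ * K ω - b⁻¹ * R ω)
      = (fun ω => a⁻¹ * K ω) - fun ω => b⁻¹ * R ω from rfl, hv]
    refine integral_congr_ae (ae_of_all _ fun ω => ?_)
    simp only [Pi.sub_apply]; ring
  rw [e, variance_fun_sub hK' hR', covariance_const_mul_left, covariance_const_mul_right, hcov,
    variance_const_mul, variance_const_mul, Real.sqrt_div' _ hRv.le, ← ha, ← hb, ha2, hb2]
  field_simp
  ring

end LimitLaw

end GaussianReduction

/-! ### The reduction theorem -/

theorem theorem4 {d p κ : ℕ} {Ω : Type*} [MeasurableSpace Ω]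
    (P : Measure Ω) [IsProbabilityMeasure P]
    (Δ : Set (EuclideanSpace ℝ (Fin d))) (hΔconv : Convex ℝ Δ) (hΔbdd : Bornology.IsBounded Δ)
    (hΔzero : (0 : EuclideanSpace ℝ (Fin d)) ∈ interior Δ)
    (η : EuclideanSpace ℝ (Fin d) → Ω → (Fin p → ℝ)) (α : ℝ) (L : ℝ → ℝ)
    (hη : IsStronglyDependentField η P α L) (hα : α < (d : ℝ) / (κ : ℝ))
    (G : ℝ → (Fin p → ℝ) → ℝ) (hG : ∀ᶠ r in atTop, HasHermiteRank (G r) κ)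
    (γ : ℝ) (hγ_pos : 0 < γ) (hγ_lt : γ < min α ((d : ℝ) - α * (κ : ℝ)))
    (hcon : (fun r : ℝ => (hermiteEnergy (G r) κ)⁻¹ * ∑' l : ℕ, hermiteEnergy (G r) (κ + 1 + l))
      =o[atTop] fun r : ℝ => r ^ (γ / 2)) :
    (∀ μ : ProbabilityMeasure ℝ,
      HasLimitLaw P (fun r ω => fullFunctional Δ G η r ω / √(Var[fullFunctional Δ G η r; P])) μ ↔
      HasLimitLaw P
        (fun r ω => rankFunctional Δ G κ η r ω / √(Var[rankFunctional Δ G κ η r; P])) μ) ∧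
    Tendsto (fun r : ℝ => Var[fullFunctional Δ G η r; P] / Var[rankFunctional Δ G κ η r; P])
      atTop (𝓝 1) := by
  have hp : 0 < p := hG.exists.choose_spec.pos_dim
  have hd : 0 < d := by
    rcases Nat.eq_zero_or_pos d with rfl | h
    · have := hη.alpha_pos
      -- For `d = 0` the bound reads `α < 0 / κ = 0`, against `0 < α`.
      norm_num at hα; linarith
    · exact h
  obtain ⟨hI, hratio⟩ := hη.tendsto_corr_integral_ratio (κ := κ) hd hp hΔbdd hΔzero hγ_pos
    (hγ_lt.trans_le (min_le_left _ _)) (hγ_lt.trans_le (min_le_right _ _))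
  set I : ℝ → ℝ := fun r => ∫ x in r • Δ, ∫ y in r • Δ, corr α L ‖x - y‖ ^ κ with hIdef
  set J : ℝ → ℝ := fun r => ∫ x in r • Δ, ∫ y in r • Δ, |corr α L ‖x - y‖| ^ (κ + 1) with hJdef
  have hVpos : ∀ᶠ r in atTop, 0 < Var[rankFunctional Δ G κ η r; P] := by
    filter_upwards [hG, hI] with r hGr hIr
    rw [hη.variance_rankFunctional hΔbdd hGr]
    exact mul_pos (hermiteEnergy_rank_pos hGr) hIr
  have hlim : Tendsto (fun r => (hermiteEnergy (G r) κ)⁻¹ *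
      (∑' l : ℕ, hermiteEnergy (G r) (κ + 1 + l)) * (J r / I r)) atTop (𝓝 0) := by
    -- The factor `r^(γ/2)` by which the energy ratio is divided is the one by which `J / I` is
    -- multiplied, so it cancels in the product.
    have h := hcon.tendsto_div_nhds_zero.mul hratio
    rw [mul_zero] at h
    refine h.congr' ?_
    filter_upwards [eventually_gt_atTop 0] with r hr
    have : r ^ (γ / 2) ≠ 0 := (Real.rpow_pos_of_pos hr _).ne'
    rw [← mul_assoc, div_mul_cancel₀ _ this]
  have hvar : Tendsto (fun r : ℝ =>
      Var[fullFunctional Δ G η r; P] / Var[rankFunctional Δ G κ η r; P]) atTop (𝓝 1) := by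
    have hrem : Tendsto (fun r => Var[fullFunctional Δ G η r - rankFunctional Δ G κ η r; P] /
        Var[rankFunctional Δ G κ η r; P]) atTop (𝓝 0) := by
      refine squeeze_zero' (Eventually.of_forall fun r =>
        div_nonneg (variance_nonneg _ _) (variance_nonneg _ _)) ?_ hlim
      filter_upwards [hG, hI] with r hGr hIr
      have hE := hermiteEnergy_rank_pos hGr
      rw [hη.variance_rankFunctional hΔbdd hGr, div_le_iff₀ (mul_pos hE hIr)]
      refine (hη.variance_remainder_le hΔbdd hGr).trans_eq ?_
      change _ * J r = _ * (J r / I r) * (_ * I r)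
      have hIr' : I r ≠ 0 := ne_of_gt hIr
      field_simp
    have h1 := hrem.const_add 1
    rw [add_zero] at h1
    refine h1.congr' ?_
    filter_upwards [hG, hVpos] with r hGr hV
    rw [hη.variance_full_eq hΔbdd hGr, add_div, div_self hV.ne']
  refine ⟨fun μ => ?_, hvar⟩
  refine hasLimitLaw_iff_of_tendsto_integral_sq_sub ?_ ?_ ?_
  · filter_upwards [hG] with r hGr
    simpa only [div_eq_inv_mul] using (hη.memLp_fullFunctional hΔbdd hGr).const_mul _
  · refine Eventually.of_forall fun r => ?_
    simpa only [div_eq_inv_mul] using (hη.memLp_rankFunctional hΔbdd G κ r).const_mul _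
  -- The limit of `2 - 2 / √(Var K_r / Var K_{r,κ})` is `2 - 2 = 0`.
  · have h := ((hvar.sqrt.inv₀ (by simp)).const_mul 2).const_sub 2
    norm_num at h
    refine h.congr' ?_
    filter_upwards [hG, hVpos] with r hGr hV
    rw [integral_sq_sub_standardized (hη.memLp_fullFunctional hΔbdd hGr)
      (hη.memLp_rankFunctional hΔbdd G κ r) (hη.integral_fullFunctional hΔbdd hGr)
      (hη.integral_rankFunctional hΔbdd hGr) (hη.covariance_full_rank hΔbdd hGr) ?_ hV]
    · simp
    · rw [hη.variance_full_eq hΔbdd hGr]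
      linarith [variance_nonneg (fullFunctional Δ G η r - rankFunctional Δ G κ η r) P]
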